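/- All variables and constants are complex and all functions are holomorphic. For an equation $\dot v=f(v_2,v_1,v,v_{-1},v_{-2})$ and a function $g(v_1,v)$ with $\partial g/\partial v_1\ne0$, $\partial g/\partial v\ne0$ everywhere on their domain, say that the equation is transformed into the Ito--Narita--Bogoyavlensky (INB) equation $\dot u=u(u_2+u_1-u_{-1}-u_{-2})$ by $u=g(v_1,v)$ if the identity $\frac{\partial g}{\partial v_1}f_1+\frac{\partial g}{\partial v}f=g\,(g_2+g_1-g_{-1}-g_{-2})$ holds identically in the independent variables $v_3,\dots,v_{-2}$, where the subscript $j$ on $f$, $g$ denotes the shift $v_i\mapsto v_{i+j}$. Consider the following five equations, each with a transformation, where $a,c$ are arbitrary constants: 1. $\dot v=v(v_2v_1-v_{-1}v_{-2})$, with $u=v_1v$; 2. $\dot v=v\left(\frac{v_2}{v_1}+2\frac{v_1}{v}+2\frac{v}{v_{-1}}+\frac{v_{-1}}{v_{-2}}\right)+cv$, with $u=v_1/v$; 3. $\dot v=v\left(v_2v_1^{\kappa}-\kappa^2v_1v^{\kappa}-vv_{-1}^{\kappa}+\kappa^2v_{-1}v_{-2}^{\kappa}\right)$, with $u=v_1v^{\kappa}$,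 where $\kappa=(1\pm i\sqrt3)/2$ and $v^\kappa$ is a holomorphic branch of the power; 4. $\dot v=(v_2-v_1+a)(v-v_{-1}+a)+(v_1-v+a)(v_{-1}-v_{-2}+a)+(v_1-v+a)(v-v_{-1}+a)+c$, with $u=v_1-v+a$; 5. $\dot v=\phi(v_2-v_1)\phi(v-v_{-1})+\phi(v_1-v)\phi(v_{-1}-v_{-2})+\phi(v_1-v)\phi(v-v_{-1})+c$, with $u=\phi(v_1-v)-1$, where $\phi$ is a solution of $\phi'=(\phi-1)/\phi$ with values different from $0$ and $1$. (i) Let $U\subset\mathbb C$ be open, $f$ holomorphic on $U^5$, $g$ holomorphic on $U^2$, and suppose that $\dot v=f$ is transformed into the INB equation by $u=g(v_1,v)$, all $v_j$ ranging over $U$. Then every point of $U$ has an open neighbourhood $V\subset U$ on which an injective holomorphic point change $\tilde v=\vartheta(v)$ and a scaling $\tilde u=\eta u$, $\tilde t=t/\eta$, $\eta\neq0$, take the equation to one of the five equations above (for some values of its constants, some branch of the power, some $\phi$) and, at the same time, the transformation $u=g(v_1,v)$ to the corresponding transformation. (ii) Conversely, each of the five equations is transformed into the INB equation by the corresponding transformation,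 on every open set $D$ of pairs of neighbouring values $(v_{n+1},v_n)$ on which the formulas make sense and $\partial u/\partial v_1$, $\partial u/\partial v$ do not vanish (so $v_n\ne0$ in the cases 1--3). -/

import Mathlib

/-- The right-hand side `f(v₂, v₁, v, v₋₁, v₋₂)` of a five-point equation `v̇ = f(v₂, v₁, v, v₋₁, v₋₂)`. -/
abbrev FivePointRHS : Type := ℂ → ℂ → ℂ → ℂ → ℂ → ℂ

/-- The right-hand side `g(v₁, v)` of a first-order transformation `u = g(v₁, v)`. -/
abbrev FirstOrderMap : Type := ℂ → ℂ → ℂ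

/-- The domain of a five-point equation whose pairs of neighbouring values `(v_{n+1}, v_n)`
range over `D`. If every `v_n` ranges over `U`, then `D = U ×ˢ U` and this is `U⁵`. -/
def fivePointDomain (D : Set (ℂ × ℂ)) : Set (ℂ × ℂ × ℂ × ℂ × ℂ) :=
  {w | (w.1, w.2.1) ∈ D ∧ (w.2.1, w.2.2.1) ∈ D ∧ (w.2.2.1, w.2.2.2.1) ∈ D ∧
    (w.2.2.2.1, w.2.2.2.2) ∈ D}

/-- `D_t g = ∂g/∂v₁ · f₁ + ∂g/∂v · f`: the derivative of `g(v₁, v)` in virtue of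
`v̇ = f(v₂, v₁, v, v₋₁, v₋₂)`. It depends on `v₃, v₂, v₁, v₀, v₋₁, v₋₂`. -/
noncomputable def totalDeriv (f : FivePointRHS) (g : FirstOrderMap)
    (v3 v2 v1 v0 vm1 vm2 : ℂ) : ℂ :=
  deriv (fun x => g x v0) v1 * f v3 v2 v1 v0 vm1 + deriv (fun y => g v1 y) v0 * f v2 v1 v0 vm1 vm2

/-- The equation `v̇ = f(v₂, v₁, v, v₋₁, v₋₂)` is transformed into the Ito–Narita–Bogoyavlensky
equation `u̇ = u (u₂ + u₁ - u₋₁ - u₋₂)` by `u = g(v₁, v)`, the pairs of neighbouring values of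
`v` ranging over `D`: `f` and `g` are holomorphic, `g` depends essentially on both arguments, and
the determining equation `D_t g = g (g₂ + g₁ - g₋₁ - g₋₂)` holds identically in the independent
variables `v₃, …, v₋₂`. -/
structure TransformsToINB (D : Set (ℂ × ℂ)) (f : FivePointRHS) (g : FirstOrderMap) : Prop where
  analytic_f : AnalyticOnNhd ℂ
    (fun w : ℂ × ℂ × ℂ × ℂ × ℂ => f w.1 w.2.1 w.2.2.1 w.2.2.2.1 w.2.2.2.2) (fivePointDomain D)
  analytic_g : AnalyticOnNhd ℂ (fun w : ℂ × ℂ => g w.1 w.2) D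
  deriv_fst_ne : ∀ x y, (x, y) ∈ D → deriv (fun s => g s y) x ≠ 0
  deriv_snd_ne : ∀ x y, (x, y) ∈ D → deriv (fun s => g x s) y ≠ 0
  determining : ∀ v3 v2 v1 v0 vm1 vm2 : ℂ, (v3, v2) ∈ D → (v2, v1) ∈ D → (v1, v0) ∈ D →
    (v0, vm1) ∈ D → (vm1, vm2) ∈ D →
    totalDeriv f g v3 v2 v1 v0 vm1 vm2 = g v1 v0 * (g v3 v2 + g v2 v1 - g v0 vm1 - g vm1 vm2)

/-- Sanity check of the definition: the transformation maps solutions of the five-point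
equation to solutions of the Ito–Narita–Bogoyavlensky equation. -/
theorem TransformsToINB.map_solution {D : Set (ℂ × ℂ)} {f : FivePointRHS} {g : FirstOrderMap}
    (h : TransformsToINB D f g) (v : ℤ → ℝ → ℂ) (t : ℝ) (hD : ∀ n, (v (n + 1) t, v n t) ∈ D)
    (hv : ∀ n, HasDerivAt (v n)
      (f (v (n + 2) t) (v (n + 1) t) (v n t) (v (n - 1) t) (v (n - 2) t)) t)
    (u : ℤ → ℝ → ℂ) (hu : ∀ n s, u n s = g (v (n + 1) s) (v n s)) (n : ℤ) :
    HasDerivAt (u n) (u n t * (u (n + 2) t + u (n + 1) t - u (n - 1) t - u (n - 2) t)) t := by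
  have hg := (h.analytic_g _ (hD n)).differentiableAt.hasFDerivAt
  set L := fderiv ℂ (fun w : ℂ × ℂ => g w.1 w.2) (v (n + 1) t, v n t) with hL
  have e1 : deriv (fun x => g x (v n t)) (v (n + 1) t) = L (1, 0) := by
    have h1 : HasDerivAt (fun x : ℂ => (x, v n t)) ((1 : ℂ), (0 : ℂ)) (v (n + 1) t) :=
      (hasDerivAt_id (v (n + 1) t)).prodMk (hasDerivAt_const (v (n + 1) t) (v n t))
    exact (hg.comp_hasDerivAt (v (n + 1) t) h1).deriv
  have e2 : deriv (fun y => g (v (n + 1) t) y) (v n t) = L (0, 1) := by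
    have h1 : HasDerivAt (fun y : ℂ => (v (n + 1) t, y)) ((0 : ℂ), (1 : ℂ)) (v n t) :=
      (hasDerivAt_const (v n t) (v (n + 1) t)).prodMk (hasDerivAt_id (v n t))
    exact (hg.comp_hasDerivAt (v n t) h1).deriv
  have hc := (hg.restrictScalars ℝ).comp_hasDerivAt t ((hv (n + 1)).prodMk (hv n))
  have hdet := h.determining (v (n + 3) t) (v (n + 2) t) (v (n + 1) t) (v n t) (v (n - 1) t)
    (v (n - 2) t) (by simpa [add_assoc] using hD (n + 2)) (by simpa [add_assoc] using hD (n + 1))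
    (hD n) (by simpa using hD (n - 1))
    (by have := hD (n - 2); rwa [show n - 2 + 1 = n - 1 by ring] at this)
  have hun : u n = (fun w : ℂ × ℂ => g w.1 w.2) ∘ fun s => (v (n + 1) s, v n s) := by
    funext s; simp [hu]
  rw [hun]
  refine hc.congr_deriv ?_
  rw [hu (n + 2), hu (n + 1), hu (n - 1), hu (n - 2)]
  simp only [Function.comp]
  rw [show n + 2 + 1 = n + 3 by ring, show n + 1 + 1 = n + 2 by ring,
    show n - 1 + 1 = n by ring, show n - 2 + 1 = n - 1 by ring, ← hdet, totalDeriv, e1, e2,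
    show n + 1 + 2 = n + 3 by ring, show n + 1 - 1 = n by ring, show n + 1 - 2 = n - 1 by ring]
  have key : ∀ a b : ℂ, L (a, b) = L (1, 0) * a + L (0, 1) * b := by
    intro a b
    have : ((a, b) : ℂ × ℂ) = a • (1, 0) + b • (0, 1) := by simp
    rw [this, map_add, map_smul, map_smul]
    simp [mul_comm]
  exact key _ _

/-- `p` is a holomorphic branch of the power function `z ↦ z ^ κ` on `S`. -/
def IsPowerBranch (κ : ℂ) (S : Set ℂ) (p : ℂ → ℂ) : Prop :=
  ∃ L : ℂ → ℂ, AnalyticOnNhd ℂ L S ∧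
    ∀ z ∈ S, Complex.exp (L z) = z ∧ p z = Complex.exp (κ * L z)

/-- The pairs (equation, transformation): the five modifications of the first level, each with
the corresponding first-order transformation. `D` is a set of pairs of neighbouring values
`(v_{n+1}, v_n)` on which the formulas make sense and the transformation is non-degenerate. -/
inductive FirstLevelModification (D : Set (ℂ × ℂ)) : FivePointRHS → FirstOrderMap → Prop
  | eq1 (hD : ∀ x y, (x, y) ∈ D → x ≠ 0 ∧ y ≠ 0) :
      FirstLevelModification D
        (fun v2 v1 v vm1 vm2 => v * (v2 * v1 - vm1 * vm2))
        (fun v1 v => v1 * v)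
  | eq2 (c : ℂ) (hD : ∀ x y, (x, y) ∈ D → x ≠ 0 ∧ y ≠ 0) :
      FirstLevelModification D
        (fun v2 v1 v vm1 vm2 => v * (v2 / v1 + 2 * (v1 / v) + 2 * (v / vm1) + vm1 / vm2) + c * v)
        (fun v1 v => v1 / v)
  | eq3 (κ : ℂ) (hκ : κ = (1 + Complex.I * Real.sqrt 3) / 2 ∨
          κ = (1 - Complex.I * Real.sqrt 3) / 2)
      (p : ℂ → ℂ) (hp : IsPowerBranch κ (Prod.fst '' D ∪ Prod.snd '' D) p) :
      FirstLevelModification D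
        (fun v2 v1 v vm1 vm2 =>
          v * (v2 * p v1 - κ ^ 2 * v1 * p v - v * p vm1 + κ ^ 2 * vm1 * p vm2))
        (fun v1 v => v1 * p v)
  | eq4 (a c : ℂ) :
      FirstLevelModification D
        (fun v2 v1 v vm1 vm2 =>
          (v2 - v1 + a) * (v - vm1 + a) + (v1 - v + a) * (vm1 - vm2 + a)
            + (v1 - v + a) * (v - vm1 + a) + c)
        (fun v1 v => v1 - v + a)
  | eq5 (c : ℂ) (φ : ℂ → ℂ)
      (hφ : ∀ x y, (x, y) ∈ D → φ (x - y) ≠ 0 ∧ φ (x - y) ≠ 1 ∧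
        HasDerivAt φ ((φ (x - y) - 1) / φ (x - y)) (x - y)) :
      FirstLevelModification D
        (fun v2 v1 v vm1 vm2 =>
          φ (v2 - v1) * φ (v - vm1) + φ (v1 - v) * φ (vm1 - vm2) + φ (v1 - v) * φ (v - vm1) + c)
        (fun v1 v => φ (v1 - v) - 1)

/-- On the domain `V`, the change of variables `ṽ = θ(v)`, `ũ = η u`, `t̃ = t / η` takes the
equation `v̇ = f` with the transformation `u = g(v₁, v)` to the equation `dṽ/dt̃ = F(ṽ₂, …, ṽ₋₂)`
with the transformation `ũ = G(ṽ₁, ṽ)`. -/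
structure IsPointChange (V : Set ℂ) (θ : ℂ → ℂ) (η : ℂ) (f F : FivePointRHS)
    (g G : FirstOrderMap) : Prop where
  analytic : AnalyticOnNhd ℂ θ V
  injOn : Set.InjOn θ V
  scale_ne : η ≠ 0
  rhs : ∀ v2 ∈ V, ∀ v1 ∈ V, ∀ v ∈ V, ∀ vm1 ∈ V, ∀ vm2 ∈ V,
    F (θ v2) (θ v1) (θ v) (θ vm1) (θ vm2) = η * (deriv θ v * f v2 v1 v vm1 vm2)
  map : ∀ v1 ∈ V, ∀ v ∈ V, G (θ v1) (θ v) = η * g v1 v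

-- The converse is direct substitution. For the classification write A = ∂g/∂v₁, B = ∂g/∂v. In the
-- determining equation v₃ and v₋₂ each occur in one value of f only, so f is explicit in its
-- outermost arguments up to a remainder r(v₁, v, v₋₁) (`exists_isRemainder`), and a relation in
-- four variables x, y, z, w remains (`reduced`). Each r there omits either x or w, so a mixed
-- second difference in x and w eliminates r. Separation of variables then makes g/B and g/A affine
-- in g with slopes α and β of one variable each, and α(y) A(y, z) = β(z) B(y, z) (`exists_affine`).
-- Since A and B have no zeros, α and β either both vanish identically or both vanish nowhere.
--
-- If they vanish, then g = C exp(l(x) + m(y)). The relation for r forces m = R l with a constant R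
-- such that (1 - R)(R³ + 1) = 0 (`separable_normal_form`). In the coordinate exp(l), the values R =
-- 1, R = -1 and R² - R + 1 = 0 give equations 1, 2 and 3.
--
-- If they do not vanish, equality of mixed partials gives α = λβ and g = βB(λg + μ) with constants
-- λ, μ, where λ² = 1 (`coupled_map`). The relation for r excludes λ = 1 (`coupled_normal_form`).
-- For λ = -1, g is a function of the difference of the values of a coordinate b with b' = 1/β. It
-- is affine in that difference if μ = 0 (equation 4), and is governed by the differential equation
-- of φ if μ ≠ 0 (equation 5).

attribute [local fun_prop] analyticAt_fst analyticAt_snd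

/-! ### The five modifications satisfy the determining equation -/

theorem transformsToINB_eq1 {D : Set (ℂ × ℂ)} (hD : ∀ x y, (x, y) ∈ D → x ≠ 0 ∧ y ≠ 0) :
    TransformsToINB D (fun v2 v1 v vm1 vm2 => v * (v2 * v1 - vm1 * vm2))
      (fun v1 v => v1 * v) where
  analytic_f := fun w _ => by fun_prop
  analytic_g := fun w _ => by fun_prop
  deriv_fst_ne := fun x y h => by simpa using (hD x y h).2
  deriv_snd_ne := fun x y h => by simpa using (hD x y h).1
  determining := fun v3 v2 v1 v0 vm1 vm2 _ _ _ _ _ => by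
    simp [totalDeriv]; ring

theorem transformsToINB_eq2 {D : Set (ℂ × ℂ)} (c : ℂ)
    (hD : ∀ x y, (x, y) ∈ D → x ≠ 0 ∧ y ≠ 0) :
    TransformsToINB D
      (fun v2 v1 v vm1 vm2 => v * (v2 / v1 + 2 * (v1 / v) + 2 * (v / vm1) + vm1 / vm2) + c * v)
      (fun v1 v => v1 / v) := by
  have e1 : ∀ x y : ℂ, deriv (fun s => s / y) x = 1 / y := fun x y =>
    ((hasDerivAt_id x).div_const y).deriv
  have e2 : ∀ x y : ℂ, deriv (fun s => x / s) y = -x / y ^ 2 := fun x y => by simp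
  refine ⟨fun w hw => ?_, fun w hw => ?_, fun x y h => ?_, fun x y h => ?_, ?_⟩
  · obtain ⟨h1, h2, h3, h4⟩ := hw
    have := (hD _ _ h1).2
    have := (hD _ _ h2).2
    have := (hD _ _ h3).2
    have := (hD _ _ h4).2
    fun_prop (disch := assumption)
  · have := (hD w.1 w.2 hw).2
    fun_prop (disch := assumption)
  · rw [e1]
    exact one_div_ne_zero (hD x y h).2
  · rw [e2]
    exact div_ne_zero (neg_ne_zero.2 (hD x y h).1) (pow_ne_zero 2 (hD x y h).2)
  · intro v3 v2 v1 v0 vm1 vm2 h1 h2 h3 h4 h5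
    have n2 := (hD _ _ h1).2
    have n1 := (hD _ _ h2).2
    have n0 := (hD _ _ h3).2
    have m1 := (hD _ _ h4).2
    have m2 := (hD _ _ h5).2
    simp only [totalDeriv]
    rw [e1, e2]
    field_simp
    ring

/-- A holomorphic branch of `z ↦ z ^ κ` on an open set is nonzero, analytic, with the usual
derivative. -/
theorem IsPowerBranch.hasDerivAt {κ : ℂ} {S : Set ℂ} {p : ℂ → ℂ} (hp : IsPowerBranch κ S p)
    (hS : IsOpen S) {z : ℂ} (hz : z ∈ S) :
    z ≠ 0 ∧ p z ≠ 0 ∧ AnalyticAt ℂ p z ∧ HasDerivAt p (κ * p z / z) z := by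
  obtain ⟨L, hL, hLp⟩ := hp
  have hnhds := hS.mem_nhds hz
  have hz0 : z ≠ 0 := by rw [← (hLp z hz).1]; exact Complex.exp_ne_zero _
  have hp0 : p z ≠ 0 := by rw [(hLp z hz).2]; exact Complex.exp_ne_zero _
  have hev : (fun w => Complex.exp (κ * L w)) =ᶠ[nhds z] p :=
    Filter.eventuallyEq_of_mem hnhds fun w hw => ((hLp w hw).2).symm
  have hid : (fun w => Complex.exp (L w)) =ᶠ[nhds z] id :=
    Filter.eventuallyEq_of_mem hnhds fun w hw => (hLp w hw).1
  have hLd := (hL z hz).differentiableAt.hasDerivAt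
  -- Differentiating exp(L(z)) = z gives L' = 1/z, whence p' = κ p / z.
  have h1 : Complex.exp (L z) * deriv L z = 1 :=
    (hLd.cexp.congr_of_eventuallyEq hid.symm).unique (hasDerivAt_id z)
  rw [(hLp z hz).1] at h1
  refine ⟨hz0, hp0, ?_, ?_⟩
  · have := hL z hz
    exact AnalyticAt.congr (by fun_prop) hev
  · refine ((hLd.const_mul κ).cexp.congr_of_eventuallyEq hev.symm).congr_deriv ?_
    rw [← (hLp z hz).2, eq_div_iff hz0]
    linear_combination p z * κ * h1

/-- The two values of κ are the primitive sixth roots of unity. This quadratic relation is all that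
the verification of equation 3 needs to know about κ. -/
theorem sq_eq_sub_one_of_eq_sixth_root {κ : ℂ}
    (hκ : κ = (1 + Complex.I * Real.sqrt 3) / 2 ∨ κ = (1 - Complex.I * Real.sqrt 3) / 2) :
    κ ^ 2 = κ - 1 := by
  have hs : ((Real.sqrt 3 : ℝ) : ℂ) ^ 2 = 3 := by
    rw [← Complex.ofReal_pow, Real.sq_sqrt (by norm_num)]; norm_num
  rcases hκ with rfl | rfl <;>
  linear_combination ((Real.sqrt 3 : ℝ) : ℂ) ^ 2 / 4 * Complex.I_sq - hs / 4

theorem transformsToINB_eq3 {D : Set (ℂ × ℂ)} (hDo : IsOpen D) {κ : ℂ}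
    (hκ : κ = (1 + Complex.I * Real.sqrt 3) / 2 ∨ κ = (1 - Complex.I * Real.sqrt 3) / 2)
    {p : ℂ → ℂ} (hp : IsPowerBranch κ (Prod.fst '' D ∪ Prod.snd '' D) p) :
    TransformsToINB D
      (fun v2 v1 v vm1 vm2 =>
        v * (v2 * p v1 - κ ^ 2 * v1 * p v - v * p vm1 + κ ^ 2 * vm1 * p vm2))
      (fun v1 v => v1 * p v) := by
  have hS : IsOpen (Prod.fst '' D ∪ Prod.snd '' D) :=
    (isOpenMap_fst _ hDo).union (isOpenMap_snd _ hDo)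
  have hp1 : ∀ x y, (x, y) ∈ D → _ := fun x y h =>
    hp.hasDerivAt hS (z := x) (Or.inl ⟨(x, y), h, rfl⟩)
  have hp2 : ∀ x y, (x, y) ∈ D → _ := fun x y h =>
    hp.hasDerivAt hS (z := y) (Or.inr ⟨(x, y), h, rfl⟩)
  have hκ2 := sq_eq_sub_one_of_eq_sixth_root hκ
  have hκ0 : κ ≠ 0 := by rintro rfl; norm_num at hκ2
  have e1 : ∀ x y : ℂ, deriv (fun s => s * p y) x = p y := fun x y => by
    simp
  have e2 : ∀ x y : ℂ, (x, y) ∈ D → deriv (fun s => x * p s) y = x * (κ * p y / y) :=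
    fun x y h => ((hp2 x y h).2.2.2.const_mul x).deriv
  refine ⟨fun w hw => ?_, fun w hw => ?_, fun x y h => ?_, fun x y h => ?_, ?_⟩
  · obtain ⟨h1, h2, h3, h4⟩ := hw
    have a1 : AnalyticAt ℂ (fun w : ℂ × ℂ × ℂ × ℂ × ℂ => p w.2.1) w :=
      (hp2 _ _ h1).2.2.1.fun_comp (f := fun w : ℂ × ℂ × ℂ × ℂ × ℂ => w.2.1) (by fun_prop)
    have a2 : AnalyticAt ℂ (fun w : ℂ × ℂ × ℂ × ℂ × ℂ => p w.2.2.1) w :=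
      (hp2 _ _ h2).2.2.1.fun_comp (f := fun w : ℂ × ℂ × ℂ × ℂ × ℂ => w.2.2.1) (by fun_prop)
    have a3 : AnalyticAt ℂ (fun w : ℂ × ℂ × ℂ × ℂ × ℂ => p w.2.2.2.1) w :=
      (hp2 _ _ h3).2.2.1.fun_comp (f := fun w : ℂ × ℂ × ℂ × ℂ × ℂ => w.2.2.2.1) (by fun_prop)
    have a4 : AnalyticAt ℂ (fun w : ℂ × ℂ × ℂ × ℂ × ℂ => p w.2.2.2.2) w :=
      (hp2 _ _ h4).2.2.1.fun_comp (f := fun w : ℂ × ℂ × ℂ × ℂ × ℂ => w.2.2.2.2) (by fun_prop)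
    have b0 : AnalyticAt ℂ (fun w : ℂ × ℂ × ℂ × ℂ × ℂ => w.1) w := by fun_prop
    have b1 : AnalyticAt ℂ (fun w : ℂ × ℂ × ℂ × ℂ × ℂ => w.2.1) w := by fun_prop
    have b2 : AnalyticAt ℂ (fun w : ℂ × ℂ × ℂ × ℂ × ℂ => w.2.2.1) w := by fun_prop
    have b3 : AnalyticAt ℂ (fun w : ℂ × ℂ × ℂ × ℂ × ℂ => w.2.2.2.1) w := by fun_prop
    have k := analyticAt_const (𝕜 := ℂ) (v := κ ^ 2) (x := w)
    exact b2.fun_mul ((((b0.fun_mul a1).fun_sub ((k.fun_mul b1).fun_mul a2)).fun_sub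
      (b2.fun_mul a3)).fun_add ((k.fun_mul b3).fun_mul a4))
  · have a1 : AnalyticAt ℂ (fun w : ℂ × ℂ => p w.2) w :=
      (hp2 w.1 w.2 hw).2.2.1.fun_comp (f := fun w : ℂ × ℂ => w.2) (by fun_prop)
    exact analyticAt_fst.fun_mul a1
  · rw [e1]; exact (hp2 x y h).2.1
  · rw [e2 x y h]
    exact mul_ne_zero (hp1 x y h).1
      (div_ne_zero (mul_ne_zero hκ0 (hp2 x y h).2.1) (hp2 x y h).1)
  · intro v3 v2 v1 v0 vm1 vm2 h1 h2 h3 h4 h5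
    have n0 := (hp2 _ _ h3).1
    simp only [totalDeriv]
    rw [e1, e2 _ _ h3]
    field_simp
    linear_combination (v1 * p v0 * (-κ * v1 * p v0 + vm1 * p vm2 * (κ + 1) - v2 * p v1
      + v0 * p vm1) - p v0 ^ 2 * v1 ^ 2) * hκ2

theorem transformsToINB_eq4 {D : Set (ℂ × ℂ)} (a c : ℂ) :
    TransformsToINB D
      (fun v2 v1 v vm1 vm2 =>
        (v2 - v1 + a) * (v - vm1 + a) + (v1 - v + a) * (vm1 - vm2 + a)
          + (v1 - v + a) * (v - vm1 + a) + c)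
      (fun v1 v => v1 - v + a) where
  analytic_f := fun w _ => by fun_prop
  analytic_g := fun w _ => by fun_prop
  deriv_fst_ne := fun x y h => by simp
  deriv_snd_ne := fun x y h => by simp
  determining := fun v3 v2 v1 v0 vm1 vm2 _ _ _ _ _ => by
    simp [totalDeriv]; ring

theorem transformsToINB_eq5 {D : Set (ℂ × ℂ)} (hDo : IsOpen D) (c : ℂ) {φ : ℂ → ℂ}
    (hφ : ∀ x y, (x, y) ∈ D → φ (x - y) ≠ 0 ∧ φ (x - y) ≠ 1 ∧
      HasDerivAt φ ((φ (x - y) - 1) / φ (x - y)) (x - y)) :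
    TransformsToINB D
      (fun v2 v1 v vm1 vm2 =>
        φ (v2 - v1) * φ (v - vm1) + φ (v1 - v) * φ (vm1 - vm2) + φ (v1 - v) * φ (v - vm1) + c)
      (fun v1 v => φ (v1 - v) - 1) := by
  -- φ is only known to be differentiable at differences of neighbouring values; these form an open
  -- set, so φ is analytic there.
  have hopen : IsOpen ((fun w : ℂ × ℂ => w.1 - w.2) '' D) := by
    have hsurj : Function.Surjective (ContinuousLinearMap.fst ℂ ℂ ℂ -
        ContinuousLinearMap.snd ℂ ℂ ℂ) := fun z => ⟨(z, 0), by simp⟩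
    exact ContinuousLinearMap.isOpenMap _ hsurj _ hDo
  have hdiff : DifferentiableOn ℂ φ ((fun w : ℂ × ℂ => w.1 - w.2) '' D) := by
    rintro _ ⟨⟨x, y⟩, h, rfl⟩
    exact (hφ x y h).2.2.differentiableAt.differentiableWithinAt
  have han : ∀ x y, (x, y) ∈ D → AnalyticAt ℂ φ (x - y) := fun x y h =>
    hdiff.analyticAt (hopen.mem_nhds ⟨(x, y), h, rfl⟩)
  have e1 : ∀ x y : ℂ, (x, y) ∈ D →
      deriv (fun s => φ (s - y) - 1) x = (φ (x - y) - 1) / φ (x - y) := fun x y h => by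
    simpa using (((hφ x y h).2.2.comp x ((hasDerivAt_id x).sub_const y)).sub_const 1).deriv
  have e2 : ∀ x y : ℂ, (x, y) ∈ D →
      deriv (fun s => φ (x - s) - 1) y = -((φ (x - y) - 1) / φ (x - y)) := fun x y h => by
    simpa using (((hφ x y h).2.2.comp y ((hasDerivAt_id y).const_sub x)).sub_const 1).deriv
  have hne : ∀ x y, (x, y) ∈ D → (φ (x - y) - 1) / φ (x - y) ≠ 0 := fun x y h =>
    div_ne_zero (sub_ne_zero.2 (hφ x y h).2.1) (hφ x y h).1
  refine ⟨fun w hw => ?_, fun w hw => ?_, fun x y h => ?_, fun x y h => ?_, ?_⟩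
  · obtain ⟨h1, h2, h3, h4⟩ := hw
    have a1 : AnalyticAt ℂ (fun w : ℂ × ℂ × ℂ × ℂ × ℂ => φ (w.1 - w.2.1)) w :=
      (han _ _ h1).fun_comp (f := fun w : ℂ × ℂ × ℂ × ℂ × ℂ => w.1 - w.2.1) (by fun_prop)
    have a2 : AnalyticAt ℂ (fun w : ℂ × ℂ × ℂ × ℂ × ℂ => φ (w.2.1 - w.2.2.1)) w :=
      (han _ _ h2).fun_comp (f := fun w : ℂ × ℂ × ℂ × ℂ × ℂ => w.2.1 - w.2.2.1) (by fun_prop)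
    have a3 : AnalyticAt ℂ (fun w : ℂ × ℂ × ℂ × ℂ × ℂ => φ (w.2.2.1 - w.2.2.2.1)) w :=
      (han _ _ h3).fun_comp (f := fun w : ℂ × ℂ × ℂ × ℂ × ℂ => w.2.2.1 - w.2.2.2.1) (by fun_prop)
    have a4 : AnalyticAt ℂ (fun w : ℂ × ℂ × ℂ × ℂ × ℂ => φ (w.2.2.2.1 - w.2.2.2.2)) w :=
      (han _ _ h4).fun_comp (f := fun w : ℂ × ℂ × ℂ × ℂ × ℂ => w.2.2.2.1 - w.2.2.2.2) (by fun_prop)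
    fun_prop
  · have a1 : AnalyticAt ℂ (fun w : ℂ × ℂ => φ (w.1 - w.2)) w :=
      (han w.1 w.2 hw).fun_comp (f := fun w : ℂ × ℂ => w.1 - w.2) (by fun_prop)
    fun_prop
  · rw [e1 x y h]; exact hne x y h
  · rw [e2 x y h]; exact neg_ne_zero.2 (hne x y h)
  · intro v3 v2 v1 v0 vm1 vm2 h1 h2 h3 h4 h5
    have n0 := (hφ _ _ h3).1
    simp only [totalDeriv]
    rw [e1 _ _ h3, e2 _ _ h3]
    field_simp
    ring

/-- Each of the five equations is transformed into the INB equation. -/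
theorem FirstLevelModification.transformsToINB {D : Set (ℂ × ℂ)} {F : FivePointRHS}
    {G : FirstOrderMap} (hDo : IsOpen D) (h : FirstLevelModification D F G) :
    TransformsToINB D F G := by
  cases h with
  | eq1 hD => exact transformsToINB_eq1 hD
  | eq2 c hD => exact transformsToINB_eq2 c hD
  | eq3 κ hκ p hp => exact transformsToINB_eq3 hDo hκ hp
  | eq4 a c => exact transformsToINB_eq4 a c
  | eq5 c φ hφ => exact transformsToINB_eq5 hDo c hφ

/-! ### One-variable tools -/

/-- A function with nonvanishing derivative at a point of an open set is not constant on it. -/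
theorem exists_ne_of_hasDerivAt {h : ℂ → ℂ} {U : Set ℂ} {a h' : ℂ} (hU : IsOpen U) (ha : a ∈ U)
    (hd : HasDerivAt h h' a) (hne : h' ≠ 0) : ∃ x ∈ U, h x ≠ h a := by
  by_contra! hc
  exact hne (hd.unique ((hasDerivAt_const a (h a)).congr_of_eventuallyEq
    (Filter.eventuallyEq_of_mem (hU.mem_nhds ha) hc)))

/-- A function with vanishing derivative on a preconnected open set is constant there. -/
theorem eq_of_hasDerivAt_zero {h : ℂ → ℂ} {U : Set ℂ} (hU : IsOpen U) (hc : IsPreconnected U)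
    (hd : ∀ x ∈ U, HasDerivAt h 0 x) {x y : ℂ} (hx : x ∈ U) (hy : y ∈ U) : h x = h y :=
  hU.is_const_of_deriv_eq_zero hc
    (fun z hz => (hd z hz).differentiableAt.differentiableWithinAt)
    (fun z hz => (hd z hz).deriv) hx hy

/-- The inverse function theorem for a holomorphic function on an open set. -/
theorem exists_openPartialHomeomorph {θ : ℂ → ℂ} {U : Set ℂ} {p : ℂ} (hU : IsOpen U)
    (hp : p ∈ U) (hθ : AnalyticAt ℂ θ p) (hne : deriv θ p ≠ 0) :
    ∃ e : OpenPartialHomeomorph ℂ ℂ, ⇑e = θ ∧ p ∈ e.source ∧ e.source ⊆ U := by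
  have hs := hθ.hasStrictDerivAt.hasStrictFDerivAt_equiv hne
  refine ⟨hs.toOpenPartialHomeomorph.restrOpen U hU, ?_, ?_, ?_⟩
  · simp
  · simpa using ⟨hs.mem_toOpenPartialHomeomorph_source, hp⟩
  · simp

/-- The partial derivative `∂g/∂v₁`. -/
noncomputable def partialFst (g : FirstOrderMap) (x y : ℂ) : ℂ := deriv (fun s => g s y) x

/-- The partial derivative `∂g/∂v`. -/
noncomputable def partialSnd (g : FirstOrderMap) (x y : ℂ) : ℂ := deriv (fun s => g x s) y

/-! ### Partial derivatives of g -/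

section Partials

variable {U : Set ℂ} {g : FirstOrderMap}

theorem hasDerivAt_fst_fderiv (hg : AnalyticOnNhd ℂ (fun w : ℂ × ℂ => g w.1 w.2) (U ×ˢ U))
    {x y : ℂ} (hx : x ∈ U) (hy : y ∈ U) :
    HasDerivAt (fun s => g s y) (fderiv ℂ (fun w : ℂ × ℂ => g w.1 w.2) (x, y) (1, 0)) x := by
  have h1 : HasDerivAt (fun s : ℂ => (s, y)) ((1 : ℂ), (0 : ℂ)) x :=
    (hasDerivAt_id x).prodMk (hasDerivAt_const x y)
  exact (hg (x, y) ⟨hx, hy⟩).differentiableAt.hasFDerivAt.comp_hasDerivAt x h1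

theorem hasDerivAt_snd_fderiv (hg : AnalyticOnNhd ℂ (fun w : ℂ × ℂ => g w.1 w.2) (U ×ˢ U))
    {x y : ℂ} (hx : x ∈ U) (hy : y ∈ U) :
    HasDerivAt (fun s => g x s) (fderiv ℂ (fun w : ℂ × ℂ => g w.1 w.2) (x, y) (0, 1)) y := by
  have h1 : HasDerivAt (fun s : ℂ => (x, s)) ((0 : ℂ), (1 : ℂ)) y :=
    (hasDerivAt_const y x).prodMk (hasDerivAt_id y)
  exact (hg (x, y) ⟨hx, hy⟩).differentiableAt.hasFDerivAt.comp_hasDerivAt y h1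

theorem hasDerivAt_partialFst (hg : AnalyticOnNhd ℂ (fun w : ℂ × ℂ => g w.1 w.2) (U ×ˢ U))
    {x y : ℂ} (hx : x ∈ U) (hy : y ∈ U) :
    HasDerivAt (fun s => g s y) (partialFst g x y) x :=
  (hasDerivAt_fst_fderiv hg hx hy).differentiableAt.hasDerivAt

theorem hasDerivAt_partialSnd (hg : AnalyticOnNhd ℂ (fun w : ℂ × ℂ => g w.1 w.2) (U ×ˢ U))
    {x y : ℂ} (hx : x ∈ U) (hy : y ∈ U) :
    HasDerivAt (fun s => g x s) (partialSnd g x y) y :=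
  (hasDerivAt_snd_fderiv hg hx hy).differentiableAt.hasDerivAt

theorem analyticOnNhd_fderiv_apply (hg : AnalyticOnNhd ℂ (fun w : ℂ × ℂ => g w.1 w.2) (U ×ˢ U))
    (v : ℂ × ℂ) :
    AnalyticOnNhd ℂ (fun w => fderiv ℂ (fun w : ℂ × ℂ => g w.1 w.2) w v) (U ×ˢ U) := fun w hw =>
  ((ContinuousLinearMap.apply ℂ ℂ v).analyticAt _).comp (hg.fderiv w hw)

theorem analyticOnNhd_partialFst (hU : IsOpen U)
    (hg : AnalyticOnNhd ℂ (fun w : ℂ × ℂ => g w.1 w.2) (U ×ˢ U)) :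
    AnalyticOnNhd ℂ (fun w : ℂ × ℂ => partialFst g w.1 w.2) (U ×ˢ U) :=
  (analyticOnNhd_fderiv_apply hg (1, 0)).congr (hU.prod hU)
    fun _ hw => (hasDerivAt_fst_fderiv hg hw.1 hw.2).deriv.symm

theorem analyticOnNhd_partialSnd (hU : IsOpen U)
    (hg : AnalyticOnNhd ℂ (fun w : ℂ × ℂ => g w.1 w.2) (U ×ˢ U)) :
    AnalyticOnNhd ℂ (fun w : ℂ × ℂ => partialSnd g w.1 w.2) (U ×ˢ U) :=
  (analyticOnNhd_fderiv_apply hg (0, 1)).congr (hU.prod hU)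
    fun _ hw => (hasDerivAt_snd_fderiv hg hw.1 hw.2).deriv.symm

/-- Equality of the mixed partial derivatives. -/
theorem exists_mixed_partial (hU : IsOpen U)
    (hg : AnalyticOnNhd ℂ (fun w : ℂ × ℂ => g w.1 w.2) (U ×ˢ U)) {x y : ℂ}
    (hx : x ∈ U) (hy : y ∈ U) :
    ∃ C, HasDerivAt (fun s => partialSnd g s y) C x ∧
      HasDerivAt (fun t => partialFst g x t) C y := by
  set Φ : ℂ × ℂ → ℂ := fun w => g w.1 w.2 with hΦ
  have hxy : (x, y) ∈ U ×ˢ U := ⟨hx, hy⟩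
  have hsymm : IsSymmSndFDerivAt ℂ Φ (x, y) :=
    (hg (x, y) hxy).contDiffAt.isSymmSndFDerivAt (n := ⊤) (by simp)
  have h2 : HasFDerivAt (fderiv ℂ Φ) (fderiv ℂ (fderiv ℂ Φ) (x, y)) (x, y) :=
    (hg.fderiv (x, y) hxy).differentiableAt.hasFDerivAt
  refine ⟨fderiv ℂ (fderiv ℂ Φ) (x, y) (1, 0) (0, 1), ?_, ?_⟩
  · have h3 : HasDerivAt (fun s => fderiv ℂ Φ (s, y)) (fderiv ℂ (fderiv ℂ Φ) (x, y) (1, 0)) x :=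
      h2.comp_hasDerivAt x ((hasDerivAt_id x).prodMk (hasDerivAt_const x y))
    have h4 := h3.clm_apply (hasDerivAt_const x ((0, 1) : ℂ × ℂ))
    simp only [map_zero, add_zero] at h4
    exact h4.congr_of_eventuallyEq (Filter.eventuallyEq_of_mem (hU.mem_nhds hx)
      fun s hs => (hasDerivAt_snd_fderiv hg hs hy).deriv)
  · have h3 : HasDerivAt (fun t => fderiv ℂ Φ (x, t)) (fderiv ℂ (fderiv ℂ Φ) (x, y) (0, 1)) y :=
      h2.comp_hasDerivAt y ((hasDerivAt_const y x).prodMk (hasDerivAt_id y))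
    have h4 := h3.clm_apply (hasDerivAt_const y ((1, 0) : ℂ × ℂ))
    simp only [map_zero, add_zero] at h4
    rw [hsymm.eq]
    exact h4.congr_of_eventuallyEq (Filter.eventuallyEq_of_mem (hU.mem_nhds hy)
      fun s hs => (hasDerivAt_fst_fderiv hg hx hs).deriv)

end Partials

/-! ### Elimination of f from the determining equation -/

section Determining

variable {U : Set ℂ} {f : FivePointRHS} {g : FirstOrderMap}

theorem TransformsToINB.partialFst_ne (h : TransformsToINB (U ×ˢ U) f g) {x y : ℂ} (hx : x ∈ U)
    (hy : y ∈ U) : partialFst g x y ≠ 0 := h.deriv_fst_ne x y ⟨hx, hy⟩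

theorem TransformsToINB.partialSnd_ne (h : TransformsToINB (U ×ˢ U) f g) {x y : ℂ} (hx : x ∈ U)
    (hy : y ∈ U) : partialSnd g x y ≠ 0 := h.deriv_snd_ne x y ⟨hx, hy⟩

theorem TransformsToINB.determining_partial (h : TransformsToINB (U ×ˢ U) f g)
    {v3 v2 v1 v0 vm1 vm2 : ℂ} (h3 : v3 ∈ U) (h2 : v2 ∈ U) (h1 : v1 ∈ U) (h0 : v0 ∈ U)
    (hm1 : vm1 ∈ U) (hm2 : vm2 ∈ U) :
    partialFst g v1 v0 * f v3 v2 v1 v0 vm1 + partialSnd g v1 v0 * f v2 v1 v0 vm1 vm2 =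
      g v1 v0 * (g v3 v2 + g v2 v1 - g v0 vm1 - g vm1 vm2) :=
  h.determining v3 v2 v1 v0 vm1 vm2 ⟨h3, h2⟩ ⟨h2, h1⟩ ⟨h1, h0⟩ ⟨h0, hm1⟩ ⟨hm1, hm2⟩

/-- The dependence of `f` on its outermost arguments: `r` is the part of `f` which depends
on `v₁, v, v₋₁` only. -/
def IsRemainder (U : Set ℂ) (f : FivePointRHS) (g : FirstOrderMap) (r : ℂ → ℂ → ℂ → ℂ) : Prop :=
  ∀ v2 ∈ U, ∀ v1 ∈ U, ∀ v0 ∈ U, ∀ vm1 ∈ U, ∀ vm2 ∈ U,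
    f v2 v1 v0 vm1 vm2 = g v0 vm1 / partialFst g v0 vm1 * g v2 v1 -
      g v1 v0 / partialSnd g v1 v0 * g vm1 vm2 + r v1 v0 vm1

/-- Changing only v₃ alters just A f₁ and g g₃,₂, which fixes the increment of f in its first
argument; v₋₂ does the same for the last one. The remainder is f with both outer arguments frozen at
p, minus the explicit terms. -/
theorem TransformsToINB.exists_isRemainder (h : TransformsToINB (U ×ˢ U) f g) {p : ℂ}
    (hp : p ∈ U) : ∃ r, IsRemainder U f g r := by
  refine ⟨fun v1 v0 vm1 => f p v1 v0 vm1 p - g v0 vm1 / partialFst g v0 vm1 * g p v1 +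
      g v1 v0 / partialSnd g v1 v0 * g vm1 p, fun v2 h2 v1 h1 v0 h0 vm1 hm1 vm2 hm2 => ?_⟩
  have hA := h.partialFst_ne h0 hm1
  have hB := h.partialSnd_ne h1 h0
  have e1 : f v2 v1 v0 vm1 vm2 - f p v1 v0 vm1 vm2 =
      g v0 vm1 / partialFst g v0 vm1 * (g v2 v1 - g p v1) := by
    field_simp
    linear_combination h.determining_partial h2 h1 h0 hm1 hm2 hp -
      h.determining_partial hp h1 h0 hm1 hm2 hp
  have e2 : f p v1 v0 vm1 vm2 - f p v1 v0 vm1 p =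
      - (g v1 v0 / partialSnd g v1 v0) * (g vm1 vm2 - g vm1 p) := by
    field_simp
    linear_combination h.determining_partial hp hp h1 h0 hm1 hm2 -
      h.determining_partial hp hp h1 h0 hm1 hp
  linear_combination e1 + e2

/-- The determining equation reduced to four independent variables. -/
theorem TransformsToINB.reduced (h : TransformsToINB (U ×ˢ U) f g) {r : ℂ → ℂ → ℂ → ℂ}
    (hr : IsRemainder U f g r) {x y z w : ℂ} (hx : x ∈ U) (hy : y ∈ U) (hz : z ∈ U)
    (hw : w ∈ U) :
    partialFst g y z * (-(g x y / partialSnd g x y) * g z w + r x y z) +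
      partialSnd g y z * (g z w / partialFst g z w * g x y + r y z w) =
      g y z * (g x y - g z w) := by
  -- The contributions of v₃ and v₋₂ cancel, so any values serve; the neighbours x and w are taken.
  have hd := h.determining_partial hx hx hy hz hw hw
  rw [hr x hx x hx y hy z hz w hw, hr x hx y hy z hz w hw w hw] at hd
  have e1 : partialFst g y z * (g y z / partialFst g y z) = g y z :=
    mul_div_cancel₀ _ (h.partialFst_ne hy hz)
  have e2 : partialSnd g y z * (g y z / partialSnd g y z) = g y z :=
    mul_div_cancel₀ _ (h.partialSnd_ne hy hz)
  linear_combination hd - g x x * e1 + g w w * e2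

/-- The functions `g / (∂g/∂v)` and `g / (∂g/∂v₁)` are affine in `g`, with coefficients
depending on one variable. -/
theorem TransformsToINB.exists_affine (hU : IsOpen U) (h : TransformsToINB (U ×ˢ U) f g) {p : ℂ}
    (hp : p ∈ U) : ∃ α β : ℂ → ℂ,
      (∀ y ∈ U, DifferentiableAt ℂ α y) ∧ (∀ y ∈ U, DifferentiableAt ℂ β y) ∧
      (∀ y ∈ U, ∀ z ∈ U, α y * partialFst g y z = β z * partialSnd g y z) ∧
      (∀ x ∈ U, ∀ y ∈ U, g x y / partialSnd g x y - g p y / partialSnd g p y =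
        α y * (g x y - g p y)) ∧
      (∀ z ∈ U, ∀ w ∈ U, g z w / partialFst g z w - g z p / partialFst g z p =
        β z * (g z w - g z p)) := by
  obtain ⟨r, hr⟩ := h.exists_isRemainder hp
  -- The mixed second difference in x and w, based at p, removes r and the right-hand side.
  have S : ∀ x ∈ U, ∀ y ∈ U, ∀ z ∈ U, ∀ w ∈ U,
      partialFst g y z * (g x y / partialSnd g x y - g p y / partialSnd g p y) *
        (g z w - g z p) =
      partialSnd g y z * (g z w / partialFst g z w - g z p / partialFst g z p) *
        (g x y - g p y) := fun x hx y hy z hz w hw => by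
    linear_combination -h.reduced hr hx hy hz hw + h.reduced hr hp hy hz hw +
      h.reduced hr hx hy hz hp - h.reduced hr hp hy hz hp
  have hw1 : ∀ z ∈ U, ∃ w ∈ U, g z w ≠ g z p := fun z hz =>
    exists_ne_of_hasDerivAt hU hp (hasDerivAt_partialSnd h.analytic_g hz hp)
      (h.partialSnd_ne hz hp)
  have hx1 : ∀ y ∈ U, ∃ x ∈ U, g x y ≠ g p y := fun y hy =>
    exists_ne_of_hasDerivAt hU hp (hasDerivAt_partialFst h.analytic_g hp hy)
      (h.partialFst_ne hp hy)
  have hβ : ∀ z ∈ U, ∃ b : ℂ, ∀ x ∈ U, ∀ y ∈ U,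
      partialFst g y z * (g x y / partialSnd g x y - g p y / partialSnd g p y) =
        b * partialSnd g y z * (g x y - g p y) := fun z hz => by
    obtain ⟨w, hw, hne⟩ := hw1 z hz
    have hne' := sub_ne_zero.2 hne
    refine ⟨(g z w / partialFst g z w - g z p / partialFst g z p) / (g z w - g z p),
      fun x hx y hy => mul_right_cancel₀ hne' ?_⟩
    rw [S x hx y hy z hz w hw]
    linear_combination -partialSnd g y z * (g x y - g p y) * div_mul_cancel₀
      (g z w / partialFst g z w - g z p / partialFst g z p) hne'
  choose! b hb using hβ
  set α : ℂ → ℂ := fun y => b p * partialSnd g y p / partialFst g y p with hα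
  have hQ : ∀ x ∈ U, ∀ y ∈ U, g x y / partialSnd g x y - g p y / partialSnd g p y =
      α y * (g x y - g p y) := fun x hx y hy => by
    refine mul_left_cancel₀ (h.partialFst_ne hy hp) ?_
    rw [hb p hp x hx y hy]
    linear_combination -(g x y - g p y) *
      mul_div_cancel₀ (b p * partialSnd g y p) (h.partialFst_ne hy hp)
  have hαb : ∀ y ∈ U, ∀ z ∈ U, α y * partialFst g y z = b z * partialSnd g y z :=
      fun y hy z hz => by
    obtain ⟨x, hx, hne⟩ := hx1 y hy
    refine mul_right_cancel₀ (sub_ne_zero.2 hne) ?_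
    linear_combination hb z hz x hx y hy - partialFst g y z * hQ x hx y hy
  have hP : ∀ z ∈ U, ∀ w ∈ U, g z w / partialFst g z w - g z p / partialFst g z p =
      b z * (g z w - g z p) := fun z hz w hw => by
    obtain ⟨x, hx, hne⟩ := hx1 p hp
    refine mul_left_cancel₀ (mul_ne_zero (h.partialSnd_ne hp hz) (sub_ne_zero.2 hne)) ?_
    linear_combination -S x hx p hp z hz w hw +
      partialFst g p z * (g z w - g z p) * hQ x hx p hp +
      (g z w - g z p) * (g x p - g p p) * hαb p hp z hz
  have hA := analyticOnNhd_partialFst hU h.analytic_g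
  have hB := analyticOnNhd_partialSnd hU h.analytic_g
  -- `b` comes from a choice; this closed formula has the same values and is visibly differentiable.
  set β : ℂ → ℂ := fun z => α p * partialFst g p z / partialSnd g p z with hβdef
  have hbβ : ∀ z ∈ U, b z = β z := fun z hz => by
    rw [hβdef, eq_div_iff (h.partialSnd_ne hp hz), hαb p hp z hz]
  refine ⟨α, β, fun y hy => ?_, fun z hz => ?_, fun y hy z hz => ?_, hQ, fun z hz w hw => ?_⟩
  · exact ((hasDerivAt_partialFst hB hy hp).differentiableAt.const_mul (b p)).fun_div
      (hasDerivAt_partialFst hA hy hp).differentiableAt (h.partialFst_ne hy hp)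
  · exact ((hasDerivAt_partialSnd hA hp hz).differentiableAt.const_mul (α p)).fun_div
      (hasDerivAt_partialSnd hB hp hz).differentiableAt (h.partialSnd_ne hp hz)
  · rw [← hbβ z hz]; exact hαb y hy z hz
  · rw [← hbβ z hz]; exact hP z hz w hw

end Determining

/-! ### The separable case, slopes zero: normal form -/

section Separable

variable {p : ℂ} {ε : ℝ} {f : FivePointRHS} {g : FirstOrderMap}

open Metric Complex

/-- If `g / (∂g/∂v₁)` and `g / (∂g/∂v)` depend on one variable only, then `g` is a product of
functions of one variable. -/
theorem TransformsToINB.exists_product (h : TransformsToINB (ball p ε ×ˢ ball p ε) f g)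
    (hp : p ∈ ball p ε)
    (hQ : ∀ x ∈ ball p ε, ∀ y ∈ ball p ε,
      g x y / partialSnd g x y = g p y / partialSnd g p y)
    (hP : ∀ z ∈ ball p ε, ∀ w ∈ ball p ε,
      g z w / partialFst g z w = g z p / partialFst g z p) :
    ∃ (e k l m : ℂ → ℂ) (C : ℂ), C ≠ 0 ∧ l p = 0 ∧ m p = 0 ∧
      (∀ x ∈ ball p ε, e x ≠ 0 ∧ k x ≠ 0 ∧ HasDerivAt l (e x)⁻¹ x ∧ HasDerivAt m (k x)⁻¹ x) ∧
      (∀ x ∈ ball p ε, ∀ y ∈ ball p ε, g x y ≠ 0 ∧ g x y = C * exp (l x) * exp (m y) ∧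
        g x y / partialFst g x y = e x ∧ g x y / partialSnd g x y = k y) := by
  -- One zero (x, y) makes g/A, which depends on x only, vanish along the whole line through it;
  -- g(x, ·) would then be zero, against B ≠ 0.
  have hg0 : ∀ x ∈ ball p ε, ∀ y ∈ ball p ε, g x y ≠ 0 := fun x hx y hy h0 => by
    have hz : ∀ t ∈ ball p ε, g x t = 0 := fun t ht => by
      have h1 := hP x hx y hy
      rw [h0, zero_div, ← hP x hx t ht] at h1
      exact (div_eq_zero_iff.1 h1.symm).resolve_right (h.partialFst_ne hx ht)
    obtain ⟨t, ht, hne⟩ := exists_ne_of_hasDerivAt isOpen_ball hy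
      (hasDerivAt_partialSnd h.analytic_g hx hy) (h.partialSnd_ne hx hy)
    exact hne (by rw [hz t ht, h0])
  have hA := analyticOnNhd_partialFst isOpen_ball h.analytic_g
  have hB := analyticOnNhd_partialSnd isOpen_ball h.analytic_g
  set e : ℂ → ℂ := fun x => g x p / partialFst g x p with he
  set k : ℂ → ℂ := fun y => g p y / partialSnd g p y with hk
  have he0 : ∀ x ∈ ball p ε, e x ≠ 0 := fun x hx =>
    div_ne_zero (hg0 x hx p hp) (h.partialFst_ne hx hp)
  have hk0 : ∀ x ∈ ball p ε, k x ≠ 0 := fun x hx =>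
    div_ne_zero (hg0 p hp x hx) (h.partialSnd_ne hp hx)
  have hed : DifferentiableOn ℂ (fun x => (e x)⁻¹) (ball p ε) := fun x hx =>
    (((hasDerivAt_partialFst h.analytic_g hx hp).differentiableAt.fun_div
      (hasDerivAt_partialFst hA hx hp).differentiableAt
      (h.partialFst_ne hx hp)).fun_inv (he0 x hx)).differentiableWithinAt
  have hkd : DifferentiableOn ℂ (fun x => (k x)⁻¹) (ball p ε) := fun x hx =>
    (((hasDerivAt_partialSnd h.analytic_g hp hx).differentiableAt.fun_div
      (hasDerivAt_partialSnd hB hp hx).differentiableAt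
      (h.partialSnd_ne hp hx)).fun_inv (hk0 x hx)).differentiableWithinAt
  obtain ⟨l, hl0, hl⟩ := hed.isExactOn_ball.with_val_at p 0
  obtain ⟨m, hm0, hm⟩ := hkd.isExactOn_ball.with_val_at p 0
  have hgA : ∀ x ∈ ball p ε, ∀ y ∈ ball p ε, g x y = partialFst g x y * e x :=
    fun x hx y hy => by
      rw [show e x = _ from (hP x hx y hy).symm, mul_div_cancel₀ _ (h.partialFst_ne hx hy)]
  have hgB : ∀ x ∈ ball p ε, ∀ y ∈ ball p ε, g x y = partialSnd g x y * k y :=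
    fun x hx y hy => by
      rw [show k y = _ from (hQ x hx y hy).symm, mul_div_cancel₀ _ (h.partialSnd_ne hx hy)]
  have hconn : IsPreconnected (ball p ε) := (convex_ball p ε).isPreconnected
  refine ⟨e, k, l, m, g p p, hg0 p hp p hp, hl0, hm0,
    fun x hx => ⟨he0 x hx, hk0 x hx, hl x hx, hm x hx⟩,
    fun x hx y hy => ⟨hg0 x hx y hy, ?_, hP x hx y hy, hQ x hx y hy⟩⟩
  have c1 : g x y * exp (-l x) = g p y * exp (-l p) :=
    eq_of_hasDerivAt_zero (h := fun s => g s y * exp (-l s)) isOpen_ball hconn (fun s hs => by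
      refine ((hasDerivAt_partialFst h.analytic_g hs hy).fun_mul
        (hl s hs).fun_neg.cexp).congr_deriv ?_
      rw [hgA s hs y hy]
      field_simp [he0 s hs]
      ring) hx hp
  have c2 : g p y * exp (-m y) = g p p * exp (-m p) :=
    eq_of_hasDerivAt_zero (h := fun s => g p s * exp (-m s)) isOpen_ball hconn (fun s hs => by
      refine ((hasDerivAt_partialSnd h.analytic_g hp hs).fun_mul
        (hm s hs).fun_neg.cexp).congr_deriv ?_
      rw [hgB p hp s hs]
      field_simp [hk0 s hs]
      ring) hy hp
  rw [hl0, neg_zero, exp_zero, mul_one, exp_neg, mul_inv_eq_iff_eq_mul₀ (exp_ne_zero _)] at c1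
  rw [hm0, neg_zero, exp_zero, mul_one, exp_neg, mul_inv_eq_iff_eq_mul₀ (exp_ne_zero _)] at c2
  rw [c1, c2]
  ring

/-- The normal form in the separable case. -/
theorem TransformsToINB.separable_normal_form (h : TransformsToINB (ball p ε ×ˢ ball p ε) f g)
    (hp : p ∈ ball p ε)
    (hQ : ∀ x ∈ ball p ε, ∀ y ∈ ball p ε,
      g x y / partialSnd g x y = g p y / partialSnd g p y)
    (hP : ∀ z ∈ ball p ε, ∀ w ∈ ball p ε,
      g z w / partialFst g z w = g z p / partialFst g z p) :
    ∃ (e l : ℂ → ℂ) (C R n : ℂ), C ≠ 0 ∧ R ≠ 0 ∧ (1 - R) * (R ^ 3 + 1) = 0 ∧ (1 + R) * n = 0 ∧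
      l p = 0 ∧ (∀ x ∈ ball p ε, e x ≠ 0 ∧ HasDerivAt l (e x)⁻¹ x) ∧
      (∀ x ∈ ball p ε, ∀ y ∈ ball p ε, g x y = C * exp (l x + R * l y)) ∧
      (∀ v2 ∈ ball p ε, ∀ v1 ∈ ball p ε, ∀ v0 ∈ ball p ε, ∀ vm1 ∈ ball p ε, ∀ vm2 ∈ ball p ε,
        f v2 v1 v0 vm1 vm2 = e v0 * (g v2 v1 + (1 - R) * g v1 v0 - R * (1 - R) * g v0 vm1 -
          R⁻¹ * g vm1 vm2 - n)) := by
  obtain ⟨e, k, l, m, C, hC, hlp, hmp, hek, hg⟩ := h.exists_product hp hQ hP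
  obtain ⟨r, hr⟩ := h.exists_isRemainder hp
  set R : ℂ → ℂ := fun y => e y / k y with hR
  have hR0 : ∀ y ∈ ball p ε, R y ≠ 0 := fun y hy => div_ne_zero (hek y hy).1 (hek y hy).2.1
  have hRk : ∀ y ∈ ball p ε, e y = R y * k y := fun y hy =>
    (div_mul_cancel₀ _ (hek y hy).2.1).symm
  have hconn : IsPreconnected (ball p ε) := (convex_ball p ε).isPreconnected
  have hred : ∀ x ∈ ball p ε, ∀ y ∈ ball p ε, ∀ z ∈ ball p ε, ∀ w ∈ ball p ε,
      r x y z / e y - g x y * (1 - R z) = -(r y z w / k z + g z w * (1 - (R y)⁻¹)) :=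
      fun x hx y hy z hz w hw => by
    have h1 := h.reduced hr hx hy hz hw
    have hA : partialFst g y z = g y z / e y := by
      rw [← (hg y hy z hz).2.2.1, div_div_cancel₀ (hg y hy z hz).1]
    have hB : partialSnd g y z = g y z / k z := by
      rw [← (hg y hy z hz).2.2.2, div_div_cancel₀ (hg y hy z hz).1]
    rw [hA, hB, (hg x hx y hy).2.2.2, (hg z hz w hw).2.2.1] at h1
    refine mul_left_cancel₀ (hg y hy z hz).1 ?_
    have n1 := (hek y hy).1
    have n2 := (hek y hy).2.1
    have n3 := (hek z hz).2.1
    simp only [hR]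
    field_simp at h1 ⊢
    linear_combination h1
  set M : ℂ → ℂ → ℂ := fun y z => r y z p / k z + g z p * (1 - (R y)⁻¹) with hM
  have hr1 : ∀ x ∈ ball p ε, ∀ y ∈ ball p ε, ∀ z ∈ ball p ε,
      r x y z / e y = g x y * (1 - R z) - M y z := fun x hx y hy z hz => by
    linear_combination hred x hx y hy z hz p hp
  have hr2 : ∀ y ∈ ball p ε, ∀ z ∈ ball p ε, ∀ w ∈ ball p ε,
      r y z w / k z = M y z - g z w * (1 - (R y)⁻¹) := fun y hy z hz w hw => by
    linear_combination hred p hp y hy z hz w hw - hred p hp y hy z hz p hp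
  have hMM : ∀ x ∈ ball p ε, ∀ y ∈ ball p ε, ∀ z ∈ ball p ε,
      R y * (g x y * (1 - R z) - M y z) = M x y - g y z * (1 - (R x)⁻¹) :=
      fun x hx y hy z hz => by
    rw [← hr1 x hx y hy z hz, ← hr2 x hx y hy z hz, hRk y hy]
    field_simp [(hek y hy).2.1, hR0 y hy]
  have hX : ∀ x ∈ ball p ε, HasDerivAt (fun s => exp (l s)) (exp (l x) * (e x)⁻¹) x :=
    fun x hx => (hek x hx).2.2.1.cexp
  have hY : ∀ x ∈ ball p ε, HasDerivAt (fun s => exp (m s)) (exp (m x) * (k x)⁻¹) x :=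
    fun x hx => (hek x hx).2.2.2.cexp
  have hXne : ∀ x ∈ ball p ε, exp (l x) * (e x)⁻¹ ≠ 0 := fun x hx =>
    mul_ne_zero (exp_ne_zero _) (inv_ne_zero (hek x hx).1)
  have hXp : exp (l p) = 1 := by rw [hlp, exp_zero]
  have hYp : exp (m p) = 1 := by rw [hmp, exp_zero]
  obtain ⟨x₁, hx₁, hX₁⟩ := exists_ne_of_hasDerivAt isOpen_ball hp (hX p hp) (hXne p hp)
  rw [hXp] at hX₁
  have hX₁' := sub_ne_zero.2 hX₁
  -- second differences of the previous identity
  have hS : ∀ x ∈ ball p ε, ∀ y ∈ ball p ε, ∀ z ∈ ball p ε,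
      -(R y * exp (m y) * (exp (l x) - 1) * (R z - R p)) =
        exp (l y) * (exp (m z) - 1) * ((R x)⁻¹ - (R p)⁻¹) := fun x hx y hy z hz => by
    refine mul_left_cancel₀ hC ?_
    have e1 := hMM x hx y hy z hz
    have e2 := hMM p hp y hy z hz
    have e3 := hMM x hx y hy p hp
    have e4 := hMM p hp y hy p hp
    rw [(hg x hx y hy).2.1, (hg y hy z hz).2.1] at e1
    rw [(hg p hp y hy).2.1, (hg y hy z hz).2.1, hXp] at e2
    rw [(hg x hx y hy).2.1, (hg y hy p hp).2.1, hYp] at e3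
    rw [(hg p hp y hy).2.1, (hg y hy p hp).2.1, hXp, hYp] at e4
    linear_combination e1 - e2 - e3 + e4
  -- With X = exp(l), Y = exp(m), a nonconstant R makes RY proportional to X by `hS`. Then Y is
  -- affine in X, and `hS` at y = p becomes a quadratic equation for X whose leading coefficient is
  -- not zero, while X is not constant.
  have hconst : ∀ z ∈ ball p ε, R z = R p := by
    by_contra! hcon
    obtain ⟨z₁, hz₁, hRz⟩ := hcon
    have hRz' := sub_ne_zero.2 hRz
    have hRY : ∀ y ∈ ball p ε, R y * exp (m y) = R p * exp (l y) := fun y hy => by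
      have e1 := hS x₁ hx₁ y hy z₁ hz₁
      have e2 := hS x₁ hx₁ p hp z₁ hz₁
      rw [hXp, hYp] at e2
      refine mul_right_cancel₀ (mul_ne_zero hX₁' hRz') ?_
      linear_combination -e1 + exp (l y) * e2
    have hYX : ∀ y ∈ ball p ε, exp (m y) - R p * exp (l y) = 1 - R p := fun y hy => by
      have := eq_of_hasDerivAt_zero (h := fun s => exp (m s) - R p * exp (l s)) isOpen_ball hconn
        (fun s hs => by
          refine ((hY s hs).sub ((hX s hs).const_mul (R p))).congr_deriv ?_
          have e1 := hRY s hs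
          rw [hRk s hs]
          field_simp [hR0 s hs, (hek s hs).2.1]
          linear_combination e1) hy hp
      simpa [hXp, hYp] using this
    have hquad : ∀ x ∈ ball p ε, (exp (l x) - 1) *
        (R p ^ 2 * (R z₁ - R p) * exp (l x) + (exp (m z₁) - 1) * (R p - 1)) = 0 :=
        fun x hx => by
      have e1 := hS x hx p hp z₁ hz₁
      have e2 := hRY x hx
      have e3 := hYX x hx
      rw [hXp, hYp] at e1
      have hRp := hR0 p hp
      have hRx := hR0 x hx
      have e4 : (R x)⁻¹ * (R p * exp (l x)) = exp (m x) := by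
        rw [← e2, inv_mul_cancel_left₀ hRx]
      have e5 : R p * (R p)⁻¹ = 1 := mul_inv_cancel₀ hRp
      linear_combination (-R p * exp (l x)) * e1 - (exp (m z₁) - 1) * e4 -
        (exp (m z₁) - 1) * e3 + (exp (m z₁) - 1) * exp (l x) * e5
    -- The factor X - 1 vanishes at p with nonzero derivative, so the derivative of `hquad` at p
    -- kills the second factor at X = 1.
    have hder : R p ^ 2 * (R z₁ - R p) + (exp (m z₁) - 1) * (R p - 1) = 0 := by
      have d1 := ((hX p hp).sub_const 1).fun_mul
        (((hX p hp).const_mul (R p ^ 2 * (R z₁ - R p))).add_const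
          ((exp (m z₁) - 1) * (R p - 1)))
      have d2 := (hasDerivAt_const p (0 : ℂ)).congr_of_eventuallyEq
        (Filter.eventuallyEq_of_mem (isOpen_ball.mem_nhds hp) hquad)
      have d3 := d1.unique d2
      refine mul_left_cancel₀ (hXne p hp) ?_
      rw [hXp] at d3 ⊢
      linear_combination d3
    have := hquad x₁ hx₁
    have hz : R p ^ 2 * (R z₁ - R p) * (exp (l x₁) - 1) ^ 2 = 0 := by
      linear_combination this - (exp (l x₁) - 1) * hder
    exact mul_ne_zero (mul_ne_zero (pow_ne_zero 2 (hR0 p hp)) hRz') (pow_ne_zero 2 hX₁') hz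
  have hRp := hR0 p hp
  have hml : ∀ y ∈ ball p ε, m y = R p * l y := fun y hy => by
    have := eq_of_hasDerivAt_zero (h := fun s => m s - R p * l s) isOpen_ball hconn
      (fun s hs => by
        refine ((hek s hs).2.2.2.sub ((hek s hs).2.2.1.const_mul (R p))).congr_deriv ?_
        rw [hRk s hs, hconst s hs]
        field_simp [(hek s hs).2.1]
        simp) hy hp
    simpa [hlp, hmp, sub_eq_zero] using this
  set n : ℂ → ℂ := fun y => M p y - R p * (1 - R p) * g p y with hn
  have hM2 : ∀ x ∈ ball p ε, ∀ y ∈ ball p ε, M x y = R p * (1 - R p) * g x y + n y :=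
      fun x hx y hy => by
    have e1 := hMM x hx y hy p hp
    have e2 := hMM p hp y hy p hp
    rw [hconst y hy, hconst x hx] at e1
    rw [hconst y hy] at e2
    simp only [hn]
    linear_combination e2 - e1
  have hM3 : ∀ x ∈ ball p ε, ∀ y ∈ ball p ε,
      (1 - R p) * (R p ^ 3 + 1) * g x y = -R p * (n x + R p * n y) := fun x hx y hy => by
    have e1 := hMM p hp x hx y hy
    rw [hM2 x hx y hy, hM2 p hp x hx, hconst y hy, hconst x hx] at e1
    have e5 : R p * (R p)⁻¹ = 1 := mul_inv_cancel₀ hRp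
    linear_combination -R p * e1 - g x y * e5
  have hcoef : (1 - R p) * (R p ^ 3 + 1) = 0 := by
    obtain ⟨y₁, hy₁, hY₁⟩ : ∃ y₁ ∈ ball p ε, exp (m y₁) ≠ 1 := by
      obtain ⟨y₁, hy₁, hne⟩ := exists_ne_of_hasDerivAt isOpen_ball hp (hY p hp)
        (mul_ne_zero (exp_ne_zero _) (inv_ne_zero (hek p hp).2.1))
      exact ⟨y₁, hy₁, by rwa [hYp] at hne⟩
    have e1 := hM3 x₁ hx₁ y₁ hy₁
    have e2 := hM3 p hp y₁ hy₁
    have e3 := hM3 x₁ hx₁ p hp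
    have e4 := hM3 p hp p hp
    rw [(hg _ hx₁ _ hy₁).2.1] at e1
    rw [(hg _ hp _ hy₁).2.1, hXp] at e2
    rw [(hg _ hx₁ _ hp).2.1, hYp] at e3
    rw [(hg _ hp _ hp).2.1, hXp, hYp] at e4
    refine (mul_eq_zero.1 (?_ : (1 - R p) * (R p ^ 3 + 1) *
      (C * ((exp (l x₁) - 1) * (exp (m y₁) - 1))) = 0)).resolve_right
      (mul_ne_zero hC (mul_ne_zero hX₁' (sub_ne_zero.2 hY₁)))
    linear_combination e1 - e2 - e3 + e4
  have hnn : ∀ x ∈ ball p ε, ∀ y ∈ ball p ε, n x + R p * n y = 0 := fun x hx y hy => by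
    have e1 := hM3 x hx y hy
    rw [hcoef, zero_mul] at e1
    exact (mul_eq_zero.1 e1.symm).resolve_left (neg_ne_zero.2 hRp)
  have hnp : ∀ x ∈ ball p ε, n x = n p := fun x hx => by
    linear_combination hnn x hx p hp - hnn p hp p hp
  refine ⟨e, l, C, R p, n p, hC, hRp, hcoef, by linear_combination hnn p hp p hp, hlp,
    fun x hx => ⟨(hek x hx).1, (hek x hx).2.2.1⟩, fun x hx y hy => ?_,
    fun v2 h2 v1 h1 v0 h0 vm1 hm1 vm2 hm2 => ?_⟩
  · rw [(hg x hx y hy).2.1, hml y hy, exp_add, mul_assoc]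
  · have e1 := hr1 v1 h1 v0 h0 vm1 hm1
    rw [div_eq_iff (hek v0 h0).1, hM2 v0 h0 vm1 hm1, hconst vm1 hm1, hnp vm1 hm1] at e1
    rw [hr v2 h2 v1 h1 v0 h0 vm1 hm1 vm2 hm2, (hg v0 h0 vm1 hm1).2.2.1, (hg v1 h1 v0 h0).2.2.2,
      e1]
    have e2 := hRk v0 h0
    rw [hconst v0 h0] at e2
    rw [e2]
    field_simp
    ring

end Separable

/-! ### The separable case: reduction to equations 1, 2, 3 -/

section SeparablePointChange

open Metric Complex

/-- The conclusion of the classification near `p`: a neighbourhood inside `U` on which a point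
change and a scaling bring the equation to one of the five modifications. -/
def IsLocallyModification (U : Set ℂ) (p : ℂ) (f : FivePointRHS) (g : FirstOrderMap) : Prop :=
  ∃ V : Set ℂ, IsOpen V ∧ p ∈ V ∧ V ⊆ U ∧
    ∃ (θ : ℂ → ℂ) (η : ℂ) (F : FivePointRHS) (G : FirstOrderMap),
      IsPointChange V θ η f F g G ∧ FirstLevelModification ((θ '' V) ×ˢ (θ '' V)) F G

theorem eq_sixth_root_of_sq_eq {κ : ℂ} (hκ : κ ^ 2 = κ - 1) :
    κ = (1 + I * Real.sqrt 3) / 2 ∨ κ = (1 - I * Real.sqrt 3) / 2 := by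
  have hs : ((Real.sqrt 3 : ℝ) : ℂ) ^ 2 = 3 := by
    rw [← ofReal_pow, Real.sq_sqrt (by norm_num)]; norm_num
  have h0 : (κ - (1 + I * Real.sqrt 3) / 2) * (κ - (1 - I * Real.sqrt 3) / 2) = 0 := by
    linear_combination hκ - ((Real.sqrt 3 : ℝ) : ℂ) ^ 2 / 4 * I_sq + hs / 4
  rcases mul_eq_zero.1 h0 with h | h
  · exact Or.inl (sub_eq_zero.1 h)
  · exact Or.inr (sub_eq_zero.1 h)

/-- In the coordinate θ = exp(l), with η = 1/C, the map becomes ṽ₁ ṽ^R, and the factor e is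
cancelled by θ' = θ/e. The constant n survives only for R = -1, as the constant of equation 2. -/
theorem isLocallyModification_of_exp {p : ℂ} {U : Set ℂ} (hU : IsOpen U) (hp : p ∈ U)
    {f : FivePointRHS} {g : FirstOrderMap} {e l : ℂ → ℂ} {C R n : ℂ} (hC : C ≠ 0) (hR : R ≠ 0)
    (hRR : (1 - R) * (R ^ 3 + 1) = 0) (hn : (1 + R) * n = 0) (hlp : l p = 0)
    (hl : ∀ x ∈ U, e x ≠ 0 ∧ HasDerivAt l (e x)⁻¹ x)
    (hg : ∀ x ∈ U, ∀ y ∈ U, g x y = C * exp (l x + R * l y))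
    (hf : ∀ v2 ∈ U, ∀ v1 ∈ U, ∀ v0 ∈ U, ∀ vm1 ∈ U, ∀ vm2 ∈ U,
        f v2 v1 v0 vm1 vm2 = e v0 * (g v2 v1 + (1 - R) * g v1 v0 - R * (1 - R) * g v0 vm1 -
          R⁻¹ * g vm1 vm2 - n)) :
    IsLocallyModification U p f g := by
  have hldiff : DifferentiableOn ℂ l U := fun x hx =>
    (hl x hx).2.differentiableAt.differentiableWithinAt
  have hθ : ∀ x ∈ U, HasDerivAt (fun s => exp (l s)) (exp (l x) * (e x)⁻¹) x :=
    fun x hx => (hl x hx).2.cexp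
  have hθan : AnalyticOnNhd ℂ (fun s => exp (l s)) U := hldiff.cexp.analyticOnNhd hU
  obtain ⟨E, hE, hpE, hEU⟩ := exists_openPartialHomeomorph hU hp (hθan p hp) (by
    rw [(hθ p hp).deriv]
    exact mul_ne_zero (exp_ne_zero _) (inv_ne_zero (hl p hp).1))
  -- The bound |Im l| < 1 < π/2 keeps exp(l) in the right half-plane, so the principal logarithm
  -- inverts it and provides the branch of the power.
  set V : Set ℂ := E.source ∩ l ⁻¹' ball 0 1 with hV
  have hVU : V ⊆ U := fun x hx => hEU hx.1
  have hVo : IsOpen V :=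
    (hldiff.continuousOn.mono hEU).isOpen_inter_preimage E.open_source isOpen_ball
  have hpV : p ∈ V := ⟨hpE, by simp [hlp]⟩
  have him : ∀ x ∈ V, |(l x).im| < 1 := fun x hx =>
    (abs_im_le_norm _).trans_lt (by simpa using hx.2)
  have hpi := Real.pi_gt_three
  have hlog : ∀ x ∈ V, log (exp (l x)) = l x := fun x hx => by
    have := abs_lt.1 (him x hx)
    exact log_exp (by linarith) (by linarith)
  have hslit : ∀ x ∈ V, exp (l x) ∈ slitPlane := fun x hx => by
    have := abs_lt.1 (him x hx)
    refine Or.inl ?_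
    rw [exp_re]
    exact mul_pos (Real.exp_pos _) (Real.cos_pos_of_mem_Ioo ⟨by linarith, by linarith⟩)
  have hchange : ∀ (F : FivePointRHS) (G : FirstOrderMap),
      (∀ v2 ∈ V, ∀ v1 ∈ V, ∀ v0 ∈ V, ∀ vm1 ∈ V, ∀ vm2 ∈ V,
        F (exp (l v2)) (exp (l v1)) (exp (l v0)) (exp (l vm1)) (exp (l vm2)) =
          exp (l v0) * (exp (l v2 + R * l v1) + (1 - R) * exp (l v1 + R * l v0) -
            R * (1 - R) * exp (l v0 + R * l vm1) - R⁻¹ * exp (l vm1 + R * l vm2) - C⁻¹ * n)) →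
      (∀ v1 ∈ V, ∀ v0 ∈ V, G (exp (l v1)) (exp (l v0)) = exp (l v1 + R * l v0)) →
      IsPointChange V (fun s => exp (l s)) C⁻¹ f F g G := fun F G hF hG =>
    { analytic := hθan.mono hVU
      injOn := by
        have := E.injOn
        rw [hE] at this
        exact this.mono Set.inter_subset_left
      scale_ne := inv_ne_zero hC
      rhs := fun v2 h2 v1 h1 v0 h0 vm1 hm1 vm2 hm2 => by
        rw [hF v2 h2 v1 h1 v0 h0 vm1 hm1 vm2 hm2, (hθ v0 (hVU h0)).deriv,
          hf v2 (hVU h2) v1 (hVU h1) v0 (hVU h0) vm1 (hVU hm1) vm2 (hVU hm2),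
          hg v2 (hVU h2) v1 (hVU h1), hg v1 (hVU h1) v0 (hVU h0), hg v0 (hVU h0) vm1 (hVU hm1),
          hg vm1 (hVU hm1) vm2 (hVU hm2)]
        have h3 := (hl v0 (hVU h0)).1
        field_simp
      map := fun v1 h1 v0 h0 => by
        rw [hG v1 h1 v0 h0, hg v1 (hVU h1) v0 (hVU h0), inv_mul_cancel_left₀ hC] }
  have hne : ∀ x y : ℂ, (x, y) ∈ ((fun s => exp (l s)) '' V) ×ˢ ((fun s => exp (l s)) '' V) →
      x ≠ 0 ∧ y ≠ 0 := by
    rintro _ _ ⟨⟨x, _, rfl⟩, ⟨y, _, rfl⟩⟩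
    exact ⟨exp_ne_zero _, exp_ne_zero _⟩
  refine ⟨V, hVo, hpV, hVU, fun s => exp (l s), C⁻¹, ?_⟩
  by_cases hR1 : R = 1
  · subst hR1
    have hn0 : n = 0 := by linear_combination hn / 2
    refine ⟨_, _, hchange _ _ (fun v2 h2 v1 h1 v0 h0 vm1 hm1 vm2 hm2 => ?_)
      (fun v1 h1 v0 h0 => ?_), FirstLevelModification.eq1 hne⟩
    · simp only [hn0, one_mul, exp_add]
      ring
    · simp only [one_mul, exp_add]
  have hR3 : (R + 1) * (R ^ 2 - R + 1) = 0 := by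
    have := (mul_eq_zero.1 hRR).resolve_left (sub_ne_zero.2 (Ne.symm hR1))
    linear_combination this
  rcases mul_eq_zero.1 hR3 with hR2 | hR2
  · obtain rfl : R = -1 := by linear_combination hR2
    refine ⟨_, _, hchange _ _ (fun v2 h2 v1 h1 v0 h0 vm1 hm1 vm2 hm2 => ?_)
      (fun v1 h1 v0 h0 => ?_), FirstLevelModification.eq2 (-(C⁻¹ * n)) hne⟩
    · simp only [neg_one_mul, exp_add, exp_neg, div_eq_mul_inv, inv_neg, inv_one]
      ring
    · simp only [neg_one_mul, exp_add, exp_neg, div_eq_mul_inv]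
  · have hκ2 : R ^ 2 = R - 1 := by linear_combination hR2
    have hn0 : n = 0 := by
      refine (mul_eq_zero.1 hn).resolve_left fun h0 => ?_
      have h3 : (3 : ℂ) = 0 := by linear_combination hκ2 - (R - 2) * h0
      norm_num at h3
    -- R² = R - 1 implies R³ = -1.
    have hRinv : R⁻¹ = -R ^ 2 := by
      refine inv_eq_of_mul_eq_one_right ?_
      linear_combination (-R - 1) * hκ2
    refine ⟨_, _, hchange _ _ (fun v2 h2 v1 h1 v0 h0 vm1 hm1 vm2 hm2 => ?_)
      (fun v1 h1 v0 h0 => ?_), FirstLevelModification.eq3 R (eq_sixth_root_of_sq_eq hκ2)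
        (fun z => exp (R * log z)) ⟨log, ?_, ?_⟩⟩
    · simp only [hlog v1 h1, hlog v0 h0, hlog vm1 hm1, hlog vm2 hm2, hn0, hRinv, exp_add]
      linear_combination exp (l v0) * (-exp (l v0) * exp (R * l vm1) -
        exp (l v1) * exp (R * l v0)) * hκ2
    · simp only [hlog v0 h0, exp_add]
    · rintro z hz
      have : z ∈ slitPlane := by
        rcases hz with ⟨w, hw, rfl⟩ | ⟨w, hw, rfl⟩
        · obtain ⟨x, hx, h⟩ := hw.1
          rw [← h]; exact hslit x hx
        · obtain ⟨x, hx, h⟩ := hw.2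
          rw [← h]; exact hslit x hx
      exact analyticAt_clog this
    · rintro z hz
      refine ⟨exp_log ?_, rfl⟩
      rcases hz with ⟨w, hw, rfl⟩ | ⟨w, hw, rfl⟩
      · exact (hne w.1 w.2 hw).1
      · exact (hne w.1 w.2 hw).2

end SeparablePointChange

/-! ### The coupled case, slopes nonzero: normal form -/

section Coupled

variable {p : ℂ} {ε : ℝ} {f : FivePointRHS} {g : FirstOrderMap}

open Metric

/-- The structure of `g` in the case where `g / (∂g/∂v)` depends on both variables: in a
coordinate with derivative `1 / β`, the function `g` depends on a sum or a difference. -/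
theorem TransformsToINB.coupled_map (h : TransformsToINB (ball p ε ×ˢ ball p ε) f g)
    (hp : p ∈ ball p ε) {α β : ℂ → ℂ}
    (hα : ∀ y ∈ ball p ε, DifferentiableAt ℂ α y) (hβ : ∀ y ∈ ball p ε, DifferentiableAt ℂ β y)
    (hαβ : ∀ y ∈ ball p ε, ∀ z ∈ ball p ε, α y * partialFst g y z = β z * partialSnd g y z)
    (hQ : ∀ x ∈ ball p ε, ∀ y ∈ ball p ε, g x y / partialSnd g x y - g p y / partialSnd g p y =
        α y * (g x y - g p y))
    (hP : ∀ z ∈ ball p ε, ∀ w ∈ ball p ε, g z w / partialFst g z w - g z p / partialFst g z p =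
        β z * (g z w - g z p))
    (hβ0 : ∀ y ∈ ball p ε, β y ≠ 0) :
    ∃ lam μ : ℂ, lam ^ 2 = 1 ∧ ∀ x ∈ ball p ε, ∀ y ∈ ball p ε, α x = lam * β x ∧
      g x y = β y * partialSnd g x y * (lam * g x y + μ) := by
  have hA := analyticOnNhd_partialFst isOpen_ball h.analytic_g
  have hB := analyticOnNhd_partialSnd isOpen_ball h.analytic_g
  have hconn : IsPreconnected (ball p ε) := (convex_ball p ε).isPreconnected
  set q : ℂ → ℂ := fun y => g p y / partialSnd g p y - α y * g p y with hq
  have hqd : ∀ y ∈ ball p ε, DifferentiableAt ℂ q y := fun y hy =>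
    ((hasDerivAt_partialSnd h.analytic_g hp hy).differentiableAt.fun_div
      (hasDerivAt_partialSnd hB hp hy).differentiableAt (h.partialSnd_ne hp hy)).fun_sub
      ((hα y hy).fun_mul (hasDerivAt_partialSnd h.analytic_g hp hy).differentiableAt)
  set R : ℂ → ℂ := fun y => α y / β y with hR
  set S : ℂ → ℂ := fun y => q y / β y with hS
  have hRd : ∀ y ∈ ball p ε, DifferentiableAt ℂ R y := fun y hy =>
    (hα y hy).fun_div (hβ y hy) (hβ0 y hy)
  have hSd : ∀ y ∈ ball p ε, DifferentiableAt ℂ S y := fun y hy =>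
    (hqd y hy).fun_div (hβ y hy) (hβ0 y hy)
  set T : ℂ → ℂ → ℂ := fun x y => β y * partialSnd g x y with hT
  have hT0 : ∀ x ∈ ball p ε, ∀ y ∈ ball p ε, T x y ≠ 0 := fun x hx y hy =>
    mul_ne_zero (hβ0 y hy) (h.partialSnd_ne hx hy)
  have hTα : ∀ x ∈ ball p ε, ∀ y ∈ ball p ε, T x y = α x * partialFst g x y :=
    fun x hx y hy => (hαβ x hx y hy).symm
  have hΓ : ∀ x ∈ ball p ε, ∀ y ∈ ball p ε, g x y = T x y * (R y * g x y + S y) :=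
      fun x hx y hy => by
    have e1 := hQ x hx y hy
    have e2 := mul_div_cancel₀ (g x y) (h.partialSnd_ne hx hy)
    have e3 : R y * β y = α y := div_mul_cancel₀ _ (hβ0 y hy)
    have e4 : S y * β y = q y := div_mul_cancel₀ _ (hβ0 y hy)
    simp only [hT]
    simp only [hq] at e4
    linear_combination -e2 + partialSnd g x y * e1 - partialSnd g x y * g x y * e3 -
      partialSnd g x y * e4
  -- The vector field α(x)∂ₓ - β(y)∂ᵧ annihilates g and, by equality of mixed partials, also T.
  -- Applied to `hΓ` it leaves only the derivatives of R and S.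
  have hkey : ∀ x ∈ ball p ε, ∀ y ∈ ball p ε, deriv R y * g x y + deriv S y = 0 :=
      fun x hx y hy => by
    obtain ⟨c, hc1, hc2⟩ := exists_mixed_partial isOpen_ball h.analytic_g hx hy
    have gx := hasDerivAt_partialFst h.analytic_g hx hy
    have gy := hasDerivAt_partialSnd h.analytic_g hx hy
    have Tx : HasDerivAt (fun s => T s y) (β y * c) x := hc1.const_mul (β y)
    have Ty : HasDerivAt (fun t => T x t) (α x * c) y :=
      (hc2.const_mul (α x)).congr_of_eventuallyEq
        (Filter.eventuallyEq_of_mem (isOpen_ball.mem_nhds hy) fun t ht => hTα x hx t ht)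
    have d1 := gx.unique ((Tx.fun_mul ((gx.const_mul (R y)).add_const (S y))).congr_of_eventuallyEq
      (Filter.eventuallyEq_of_mem (isOpen_ball.mem_nhds hx) fun s hs => hΓ s hs y hy))
    have d2 := gy.unique ((Ty.fun_mul (((hRd y hy).hasDerivAt.fun_mul gy).fun_add
      (hSd y hy).hasDerivAt)).congr_of_eventuallyEq
      (Filter.eventuallyEq_of_mem (isOpen_ball.mem_nhds hy) fun t ht => hΓ x hx t ht))
    refine mul_left_cancel₀ (mul_ne_zero (hβ0 y hy) (hT0 x hx y hy)) ?_
    linear_combination α x * d1 - β y * d2 - (1 - T x y * R y) * hαβ x hx y hy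
  have hR' : ∀ y ∈ ball p ε, deriv R y = 0 := fun y hy => by
    obtain ⟨x, hx, hne⟩ := exists_ne_of_hasDerivAt isOpen_ball hp
      (hasDerivAt_partialFst h.analytic_g hp hy) (h.partialFst_ne hp hy)
    refine (mul_eq_zero.1 (?_ : deriv R y * (g x y - g p y) = 0)).resolve_right
      (sub_ne_zero.2 hne)
    linear_combination hkey x hx y hy - hkey p hp y hy
  have hS' : ∀ y ∈ ball p ε, deriv S y = 0 := fun y hy => by
    linear_combination hkey p hp y hy - g p y * hR' y hy
  have hRc : ∀ y ∈ ball p ε, R y = R p := fun y hy =>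
    eq_of_hasDerivAt_zero isOpen_ball hconn
      (fun s hs => hR' s hs ▸ (hRd s hs).hasDerivAt) hy hp
  have hSc : ∀ y ∈ ball p ε, S y = S p := fun y hy =>
    eq_of_hasDerivAt_zero isOpen_ball hconn
      (fun s hs => hS' s hs ▸ (hSd s hs).hasDerivAt) hy hp
  have hαR : ∀ y ∈ ball p ε, α y = R p * β y := fun y hy => by
    rw [← hRc y hy]
    exact (div_mul_cancel₀ _ (hβ0 y hy)).symm
  refine ⟨R p, S p, ?_, fun x hx y hy => ⟨hαR x hx, ?_⟩⟩
  -- The slope of g/A in g is β by `hP`, and αλ = λ²β by `hΓ`.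
  · obtain ⟨w, hw, hne⟩ := exists_ne_of_hasDerivAt isOpen_ball hp
      (hasDerivAt_partialSnd h.analytic_g hp hp) (h.partialSnd_ne hp hp)
    have e0 : ∀ y ∈ ball p ε, g p y / partialFst g p y = α p * (R p * g p y + S p) :=
        fun y hy => by
      rw [div_eq_iff (h.partialFst_ne hp hy)]
      have := hΓ p hp y hy
      rw [hTα p hp y hy, hRc y hy, hSc y hy] at this
      linear_combination this
    have e1 := hP p hp w hw
    rw [e0 w hw, e0 p hp, hαR p hp] at e1
    refine mul_left_cancel₀ (mul_ne_zero (hβ0 p hp) (sub_ne_zero.2 hne)) ?_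
    linear_combination e1
  · have := hΓ x hx y hy
    rwa [hRc y hy, hSc y hy] at this

/-- The normal form in the case where `g / (∂g/∂v)` depends on both variables. -/
theorem TransformsToINB.coupled_normal_form (h : TransformsToINB (ball p ε ×ˢ ball p ε) f g)
    (hp : p ∈ ball p ε) {α β : ℂ → ℂ}
    (hα : ∀ y ∈ ball p ε, DifferentiableAt ℂ α y) (hβ : ∀ y ∈ ball p ε, DifferentiableAt ℂ β y)
    (hαβ : ∀ y ∈ ball p ε, ∀ z ∈ ball p ε, α y * partialFst g y z = β z * partialSnd g y z)
    (hQ : ∀ x ∈ ball p ε, ∀ y ∈ ball p ε, g x y / partialSnd g x y - g p y / partialSnd g p y =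
        α y * (g x y - g p y))
    (hP : ∀ z ∈ ball p ε, ∀ w ∈ ball p ε, g z w / partialFst g z w - g z p / partialFst g z p =
        β z * (g z w - g z p))
    (hβ0 : ∀ y ∈ ball p ε, β y ≠ 0) :
    ∃ μ c : ℂ,
      (∀ x ∈ ball p ε, ∀ y ∈ ball p ε,
        g x y = β y * partialSnd g x y * (μ - g x y) ∧
        g x y = -(β x * partialFst g x y * (μ - g x y))) ∧
      (∀ v2 ∈ ball p ε, ∀ v1 ∈ ball p ε, ∀ v0 ∈ ball p ε, ∀ vm1 ∈ ball p ε, ∀ vm2 ∈ ball p ε,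
        f v2 v1 v0 vm1 vm2 = β v0 * ((g v2 v1 - μ) * (g v0 vm1 - μ) +
          (g v1 v0 - μ) * (g vm1 vm2 - μ) + (g v1 v0 - μ) * (g v0 vm1 - μ) + c)) := by
  obtain ⟨lam, μ, hlam, hmap⟩ := h.coupled_map hp hα hβ hαβ hQ hP hβ0
  obtain ⟨r, hr⟩ := h.exists_isRemainder hp
  have hlam0 : lam ≠ 0 := by rintro rfl; norm_num at hlam
  have hBd : ∀ x ∈ ball p ε, ∀ y ∈ ball p ε,
      g x y / partialSnd g x y = β y * (lam * g x y + μ) := fun x hx y hy => by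
    rw [div_eq_iff (h.partialSnd_ne hx hy)]
    linear_combination (hmap x hx y hy).2
  have hAeq : ∀ x ∈ ball p ε, ∀ y ∈ ball p ε,
      β y * partialSnd g x y = lam * β x * partialFst g x y := fun x hx y hy => by
    rw [← (hmap x hx y hy).1, hαβ x hx y hy]
  have hAd : ∀ x ∈ ball p ε, ∀ y ∈ ball p ε,
      g x y / partialFst g x y = lam * β x * (lam * g x y + μ) := fun x hx y hy => by
    rw [div_eq_iff (h.partialFst_ne hx hy)]
    linear_combination (hmap x hx y hy).2 + (lam * g x y + μ) * hAeq x hx y hy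
  have hred : ∀ x ∈ ball p ε, ∀ y ∈ ball p ε, ∀ z ∈ ball p ε, ∀ w ∈ ball p ε,
      lam * (r x y z / β y) + r y z w / β z = (lam * g y z + μ - lam * μ) *
        (g x y - g z w) := fun x hx y hy z hz w hw => by
    have e1 := h.reduced hr hx hy hz hw
    rw [hBd x hx y hy, hAd z hz w hw] at e1
    have e2 := (hmap y hy z hz).2
    have e3 := hAeq y hy z hz
    have e4 : r x y z / β y * β y = r x y z := div_mul_cancel₀ _ (hβ0 y hy)
    have e5 : r y z w / β z * β z = r y z w := div_mul_cancel₀ _ (hβ0 z hz)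
    refine mul_left_cancel₀ (mul_ne_zero (hβ0 z hz) (h.partialSnd_ne hy hz)) ?_
    rw [← e4, ← e5] at e1
    linear_combination e1 + (g x y - g z w) * e2 +
      (r x y z / β y * lam - (lam * g x y + μ) * g z w * lam) * e3 +
      β y * partialFst g y z * (r x y z / β y - lam * g x y * g z w - g z w * μ) * hlam
  set M : ℂ → ℂ → ℂ := fun y z => r y z p / β z + (lam * g y z + μ - lam * μ) * g z p with hM
  have hr1 : ∀ y ∈ ball p ε, ∀ z ∈ ball p ε, ∀ w ∈ ball p ε,
      r y z w / β z = M y z - (lam * g y z + μ - lam * μ) * g z w := fun y hy z hz w hw => by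
    linear_combination hred p hp y hy z hz w hw - hred p hp y hy z hz p hp
  have hMM : ∀ x ∈ ball p ε, ∀ y ∈ ball p ε, ∀ z ∈ ball p ε,
      lam * (M x y - (lam * g x y + μ - lam * μ) * g y z) =
        (lam * g y z + μ - lam * μ) * g x y - M y z := fun x hx y hy z hz => by
    linear_combination hred x hx y hy z hz p hp - lam * hr1 x hx y hy z hz
  obtain rfl : lam = -1 := by
    have h1 : (lam - 1) * (lam + 1) = 0 := by linear_combination hlam
    rcases mul_eq_zero.1 h1 with h2 | h2
    · obtain rfl : lam = 1 := by linear_combination h2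
      obtain ⟨x, hx, hxne⟩ := exists_ne_of_hasDerivAt isOpen_ball hp
        (hasDerivAt_partialFst h.analytic_g hp hp) (h.partialFst_ne hp hp)
      obtain ⟨z, hz, hzne⟩ := exists_ne_of_hasDerivAt isOpen_ball hp
        (hasDerivAt_partialSnd h.analytic_g hp hp) (h.partialSnd_ne hp hp)
      refine absurd ?_ (mul_ne_zero (sub_ne_zero.2 hxne) (sub_ne_zero.2 hzne))
      linear_combination (-hMM x hx p hp z hz + hMM p hp p hp z hz + hMM x hx p hp p hp -
        hMM p hp p hp p hp) / 2
    · linear_combination h2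
  have hN : ∀ y ∈ ball p ε, ∀ z ∈ ball p ε, M y z + 2 * μ * g y z = M p p + 2 * μ * g p p :=
      fun y hy z hz => by
    linear_combination hMM p hp y hy z hz + hMM p hp p hp y hy
  refine ⟨μ, M p p + 2 * μ * g p p - 3 * μ ^ 2, fun x hx y hy => ⟨?_, ?_⟩,
    fun v2 h2 v1 h1 v0 h0 vm1 hm1 vm2 hm2 => ?_⟩
  · linear_combination (hmap x hx y hy).2
  · linear_combination (hmap x hx y hy).2 + (μ - g x y) * hAeq x hx y hy
  · rw [hr v2 h2 v1 h1 v0 h0 vm1 hm1 vm2 hm2, hAd v0 h0 vm1 hm1, hBd v1 h1 v0 h0]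
    have e1 := hr1 v1 h1 v0 h0 vm1 hm1
    rw [div_eq_iff (hβ0 v0 h0)] at e1
    rw [e1]
    linear_combination β v0 * hN v1 h1 v0 h0

end Coupled

/-! ### The coupled case: reduction to equations 4, 5 -/

section CoupledPointChange

variable {p : ℂ} {ε : ℝ} {f : FivePointRHS} {g : FirstOrderMap}

open Metric

/-- This is μ = 0: cancelling g in `hmap` makes the derivatives of g in the coordinate b equal to 1
and -1, so g(x, y) = b(x) - b(y) + g(p, p). -/
theorem isLocallyModification_of_difference {U : Set ℂ} (hU : IsOpen U) (hc : IsPreconnected U)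
    (hp : p ∈ U) (hg : AnalyticOnNhd ℂ (fun w : ℂ × ℂ => g w.1 w.2) (U ×ˢ U))
    (hA : ∀ x ∈ U, ∀ y ∈ U, partialFst g x y ≠ 0) (hB : ∀ x ∈ U, ∀ y ∈ U, partialSnd g x y ≠ 0)
    {β b : ℂ → ℂ} (hβ0 : ∀ y ∈ U, β y ≠ 0) (hb : ∀ y ∈ U, HasDerivAt b (β y)⁻¹ y) {c : ℂ}
    (hmap : ∀ x ∈ U, ∀ y ∈ U, g x y = -(β y * partialSnd g x y * g x y) ∧
      g x y = β x * partialFst g x y * g x y)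
    (hf : ∀ v2 ∈ U, ∀ v1 ∈ U, ∀ v0 ∈ U, ∀ vm1 ∈ U, ∀ vm2 ∈ U,
      f v2 v1 v0 vm1 vm2 = β v0 * (g v2 v1 * g v0 vm1 + g v1 v0 * g vm1 vm2 +
        g v1 v0 * g v0 vm1 + c)) :
    IsLocallyModification U p f g := by
  have hT : ∀ x ∈ U, ∀ y ∈ U, β y * partialSnd g x y = -1 ∧ β x * partialFst g x y = 1 :=
      fun x hx y hy => by
    -- At a zero of g nothing can be cancelled, but differentiating `hmap` there leaves only the
    -- term with the derivative of g, which is nonzero.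
    by_cases h0 : g x y = 0
    · obtain ⟨C, hc1, hc2⟩ := exists_mixed_partial hU hg hx hy
      have gx := hasDerivAt_partialFst hg hx hy
      have gy := hasDerivAt_partialSnd hg hx hy
      have d1 := gx.unique ((((hc1.const_mul (β y)).fun_mul gx).fun_neg).congr_of_eventuallyEq
        (Filter.eventuallyEq_of_mem (hU.mem_nhds hx) fun s hs => (hmap s hs y hy).1))
      have d2 := gy.unique (((hc2.const_mul (β x)).fun_mul gy).congr_of_eventuallyEq
        (Filter.eventuallyEq_of_mem (hU.mem_nhds hy) fun t ht => (hmap x hx t ht).2))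
      rw [h0] at d1 d2
      exact ⟨mul_right_cancel₀ (hA x hx y hy) (by linear_combination d1),
        mul_right_cancel₀ (hB x hx y hy) (by linear_combination -d2)⟩
    · exact ⟨mul_right_cancel₀ h0 (by linear_combination (hmap x hx y hy).1),
        mul_right_cancel₀ h0 (by linear_combination -(hmap x hx y hy).2)⟩
  have hgb : ∀ x ∈ U, ∀ y ∈ U, g x y = b x - b y + g p p := fun x hx y hy => by
    have c1 := eq_of_hasDerivAt_zero (h := fun s => g s y - b s) hU hc (fun s hs => by
      refine ((hasDerivAt_partialFst hg hs hy).fun_sub (hb s hs)).congr_deriv ?_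
      rw [sub_eq_zero]
      exact eq_inv_of_mul_eq_one_right (hT s hs y hy).2) hx hp
    have c2 := eq_of_hasDerivAt_zero (h := fun s => g p s + b s) hU hc (fun s hs => by
      refine ((hasDerivAt_partialSnd hg hp hs).fun_add (hb s hs)).congr_deriv ?_
      rw [← mul_right_inj' (hβ0 s hs), mul_add, mul_inv_cancel₀ (hβ0 s hs), (hT p hp s hs).1]
      ring) hy hp
    linear_combination c1 + c2
  have hban : AnalyticOnNhd ℂ b U :=
    DifferentiableOn.analyticOnNhd (fun x hx =>
      (hb x hx).differentiableAt.differentiableWithinAt) hU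
  obtain ⟨E, hE, hpE, hEU⟩ := exists_openPartialHomeomorph hU hp (hban p hp) (by
    rw [(hb p hp).deriv]
    exact inv_ne_zero (hβ0 p hp))
  refine ⟨E.source, E.open_source, hpE, hEU, b, 1, _, _, ?_,
    FirstLevelModification.eq4 (g p p) c⟩
  refine ⟨hban.mono hEU, hE ▸ E.injOn, one_ne_zero,
    fun v2 h2 v1 h1 v0 h0 vm1 hm1 vm2 hm2 => ?_, fun v1 h1 v0 h0 => ?_⟩
  · rw [hf v2 (hEU h2) v1 (hEU h1) v0 (hEU h0) vm1 (hEU hm1) vm2 (hEU hm2),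
      (hb v0 (hEU h0)).deriv, inv_mul_cancel_left₀ (hβ0 v0 (hEU h0)), one_mul,
      hgb v2 (hEU h2) v1 (hEU h1), hgb v1 (hEU h1) v0 (hEU h0), hgb v0 (hEU h0) vm1 (hEU hm1),
      hgb vm1 (hEU hm1) vm2 (hEU hm2)]
  · rw [hgb v1 (hEU h1) v0 (hEU h0), one_mul]

/-- This is μ ≠ 0: `hmap` forces g to avoid 0 and μ and to be invariant under simultaneous
translation of both arguments in the coordinate b. Thus φ = 1 - g/μ is a function of the difference
which avoids 1 and 0. -/
theorem isLocallyModification_of_function_of_difference {U : Set ℂ} (hU : IsOpen U)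
    (hp : p ∈ U) (hg : AnalyticOnNhd ℂ (fun w : ℂ × ℂ => g w.1 w.2) (U ×ˢ U))
    {β b : ℂ → ℂ} (hβ0 : ∀ y ∈ U, β y ≠ 0) (hb : ∀ y ∈ U, HasDerivAt b (β y)⁻¹ y) {c μ : ℂ}
    (hμ : μ ≠ 0)
    (hmap : ∀ x ∈ U, ∀ y ∈ U, g x y = β y * partialSnd g x y * (μ - g x y) ∧
      g x y = -(β x * partialFst g x y * (μ - g x y)))
    (hf : ∀ v2 ∈ U, ∀ v1 ∈ U, ∀ v0 ∈ U, ∀ vm1 ∈ U, ∀ vm2 ∈ U,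
      f v2 v1 v0 vm1 vm2 = β v0 * ((g v2 v1 - μ) * (g v0 vm1 - μ) +
        (g v1 v0 - μ) * (g vm1 vm2 - μ) + (g v1 v0 - μ) * (g v0 vm1 - μ) + c))
    (hB : ∀ x ∈ U, ∀ y ∈ U, partialSnd g x y ≠ 0) :
    IsLocallyModification U p f g := by
  have hg0 : ∀ x ∈ U, ∀ y ∈ U, g x y ≠ 0 ∧ μ - g x y ≠ 0 := fun x hx y hy => by
    have e1 := (hmap x hx y hy).1
    have h1 : μ - g x y ≠ 0 := fun h0 => by
      rw [h0, mul_zero] at e1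
      exact hμ (by linear_combination h0 + e1)
    exact ⟨by rw [e1]; exact mul_ne_zero (mul_ne_zero (hβ0 y hy) (hB x hx y hy)) h1, h1⟩
  -- The factor -1/μ turns dφ/dθ(x) = βA = -g/(μ - g) into exactly (φ - 1)/φ.
  set θ : ℂ → ℂ := fun x => -μ⁻¹ * b x with hθdef
  have hθ : ∀ x ∈ U, HasDerivAt θ (-μ⁻¹ * (β x)⁻¹) x := fun x hx => (hb x hx).const_mul _
  have hθ0 : ∀ x ∈ U, -μ⁻¹ * (β x)⁻¹ ≠ 0 := fun x hx =>
    mul_ne_zero (neg_ne_zero.2 (inv_ne_zero hμ)) (inv_ne_zero (hβ0 x hx))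
  have hθan : AnalyticOnNhd ℂ θ U :=
    DifferentiableOn.analyticOnNhd (fun x hx =>
      (hθ x hx).differentiableAt.differentiableWithinAt) hU
  obtain ⟨E, hE, hpE, hEU⟩ := exists_openPartialHomeomorph hU hp (hθan p hp) (by
    rw [(hθ p hp).deriv]
    exact hθ0 p hp)
  have hpT : θ p ∈ E.target := by rw [← hE]; exact E.map_source hpE
  obtain ⟨δ', hδ', hball⟩ := Metric.isOpen_iff.1 E.open_target _ hpT
  -- Coordinates within δ of θ(p) have differences of size below 2δ, where the inverse ψ is still
  -- defined.
  obtain ⟨δ, hδ, rfl⟩ : ∃ δ : ℝ, 0 < δ ∧ δ' = 2 * δ := ⟨δ' / 2, by linarith, by ring⟩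
  set ψ := E.symm with hψdef
  have hψU : ∀ s ∈ ball (θ p) (2 * δ), ψ s ∈ U := fun s hs => hEU (E.map_target (hball hs))
  have hψ : ∀ s ∈ ball (θ p) (2 * δ), HasDerivAt ψ (-μ⁻¹ * (β (ψ s))⁻¹)⁻¹ s := fun s hs =>
    E.hasDerivAt_symm (hball hs) (hθ0 _ (hψU s hs)) (hE ▸ hθ _ (hψU s hs))
  have hψθ : ∀ x ∈ E.source, ψ (θ x) = x := fun x hx => by
    rw [← hE]; exact E.left_inv hx
  set V : Set ℂ := E.source ∩ θ ⁻¹' ball (θ p) δ with hV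
  have hVU : V ⊆ U := fun x hx => hEU hx.1
  have hVo : IsOpen V :=
    (hθan.continuousOn.mono hEU).isOpen_inter_preimage E.open_source isOpen_ball
  have hpV : p ∈ V := ⟨hpE, by simpa using hδ⟩
  have hsub : ∀ x ∈ V, ∀ y ∈ V, θ p + (θ x - θ y) ∈ ball (θ p) (2 * δ) := fun x hx y hy => by
    have h1 : dist (θ x) (θ p) < δ := hx.2
    have h2 : dist (θ y) (θ p) < δ := hy.2
    rw [mem_ball, dist_eq_norm, add_sub_cancel_left, ← dist_eq_norm]
    linarith [dist_triangle_right (θ x) (θ y) (θ p)]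
  -- `g` depends on the difference of the new coordinates only
  have hdiff : ∀ x ∈ V, ∀ y ∈ V, g (ψ (θ p + (θ x - θ y))) p = g x y := fun x hx y hy => by
    -- W is the convex set of admissible common translations τ. It contains 0, which gives g(x, y),
    -- and θ(p) - θ(y), which moves the second argument to p.
    set W : Set ℂ := (fun τ => θ x + τ) ⁻¹' ball (θ p) (2 * δ) ∩
      (fun τ => θ y + τ) ⁻¹' ball (θ p) (2 * δ) with hW
    have hWo : IsOpen W := (isOpen_ball.preimage (by fun_prop)).inter
      (isOpen_ball.preimage (by fun_prop))
    have hWc : IsPreconnected W := (((convex_ball (θ p) (2 * δ)).translate_preimage_right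
      (θ x)).inter ((convex_ball (θ p) (2 * δ)).translate_preimage_right (θ y))).isPreconnected
    have h0 : (0 : ℂ) ∈ W := by
      have h1 : dist (θ x) (θ p) < δ := hx.2
      have h2 : dist (θ y) (θ p) < δ := hy.2
      constructor
      · simp only [Set.mem_preimage, add_zero, mem_ball]; linarith
      · simp only [Set.mem_preimage, add_zero, mem_ball]; linarith
    have h1 : θ p - θ y ∈ W := by
      constructor
      · have := hsub x hx y hy
        rw [Set.mem_preimage]
        convert this using 1
        ring
      · rw [Set.mem_preimage, add_sub_cancel]
        exact mem_ball_self (by linarith)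
    have := eq_of_hasDerivAt_zero (h := fun τ => g (ψ (θ x + τ)) (ψ (θ y + τ))) hWo hWc
      (fun τ hτ => by
        have u1 := hψU _ hτ.1
        have u2 := hψU _ hτ.2
        have d1 := (hψ _ hτ.1).comp_const_add (θ x) τ
        have d2 := (hψ _ hτ.2).comp_const_add (θ y) τ
        have d3 := (hg (ψ (θ x + τ), ψ (θ y + τ)) ⟨u1, u2⟩).differentiableAt.hasFDerivAt
        have d4 := d3.comp_hasDerivAt τ (d1.prodMk d2)
        refine d4.congr_deriv ?_
        set L := fderiv ℂ (fun w : ℂ × ℂ => g w.1 w.2) (ψ (θ x + τ), ψ (θ y + τ))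
        have key : ∀ a b : ℂ, L (a, b) = L (1, 0) * a + L (0, 1) * b := by
          intro a b
          have : ((a, b) : ℂ × ℂ) = a • (1, 0) + b • (0, 1) := by simp
          rw [this, map_add, map_smul, map_smul]
          simp [mul_comm]
        have e1 : L (1, 0) = partialFst g (ψ (θ x + τ)) (ψ (θ y + τ)) :=
          (hasDerivAt_fst_fderiv hg u1 u2).deriv.symm
        have e2 : L (0, 1) = partialSnd g (ψ (θ x + τ)) (ψ (θ y + τ)) :=
          (hasDerivAt_snd_fderiv hg u1 u2).deriv.symm
        rw [key, e1, e2]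
        have m1 := hmap _ u1 _ u2
        refine mul_right_cancel₀ (hg0 _ u1 _ u2).2 ?_
        have n1 := hβ0 _ u1
        have n2 := hβ0 _ u2
        field_simp
        linear_combination μ * (m1.1 - m1.2)) h1 h0
    simp only [add_zero, add_sub_cancel, hψθ x hx.1, hψθ y hy.1, hψθ p hpE] at this
    rw [← this]
    congr 2
    ring
  set φ : ℂ → ℂ := fun s => 1 - μ⁻¹ * g (ψ (θ p + s)) p with hφ
  have hφg : ∀ x ∈ V, ∀ y ∈ V, φ (θ x - θ y) = 1 - μ⁻¹ * g x y := fun x hx y hy => by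
    simp only [hφ, hdiff x hx y hy]
  refine ⟨V, hVo, hpV, hVU, θ, -μ⁻¹, _, _, ?_,
    FirstLevelModification.eq5 (μ⁻¹ ^ 2 * c) φ ?_⟩
  · refine ⟨hθan.mono hVU, ?_, neg_ne_zero.2 (inv_ne_zero hμ),
      fun v2 h2 v1 h1 v0 h0 vm1 hm1 vm2 hm2 => ?_, fun v1 h1 v0 h0 => ?_⟩
    · have := E.injOn
      rw [hE] at this
      exact this.mono Set.inter_subset_left
    · rw [hφg v2 h2 v1 h1, hφg v1 h1 v0 h0, hφg v0 h0 vm1 hm1, hφg vm1 hm1 vm2 hm2,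
        (hθ v0 (hVU h0)).deriv,
        hf v2 (hVU h2) v1 (hVU h1) v0 (hVU h0) vm1 (hVU hm1) vm2 (hVU hm2)]
      have n1 := hβ0 v0 (hVU h0)
      field_simp
      ring
    · rw [hφg v1 h1 v0 h0]
      ring
  · rintro _ _ ⟨⟨x, hx, rfl⟩, ⟨y, hy, rfl⟩⟩
    have hs := hsub x hx y hy
    have u := hψU _ hs
    have d1 := (hψ _ hs).comp_const_add (θ p) (θ x - θ y)
    have d2 := (((hasDerivAt_partialFst hg u hp).comp (θ x - θ y) d1).const_mul
      μ⁻¹).const_sub 1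
    have h0 := hg0 x (hVU hx) y (hVU hy)
    have hm := (hmap _ u p hp).2
    rw [hdiff x hx y hy] at hm
    have hφ0 : φ (θ x - θ y) ≠ 0 := by
      rw [hφg x hx y hy]
      intro h
      refine h0.2 ?_
      field_simp at h
      rw [h, mul_zero]
    refine ⟨hφ0, ?_, ?_⟩
    · rw [hφg x hx y hy]
      intro h
      exact mul_ne_zero (inv_ne_zero hμ) h0.1 (by linear_combination -h)
    · refine d2.congr_deriv ?_
      rw [eq_div_iff hφ0, hφg x hx y hy]
      have n1 := hβ0 _ u
      field_simp
      linear_combination hm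

/-! ### The dichotomy and the two directions together -/

/-- Every equation transformed into the INB equation by a first-order transformation is locally
one of the five modifications up to a point change and a scaling. -/
theorem TransformsToINB.isLocallyModification {U : Set ℂ} (hU : IsOpen U)
    (h : TransformsToINB (U ×ˢ U) f g) (hp : p ∈ U) : IsLocallyModification U p f g := by
  obtain ⟨ε, hε, hball⟩ := Metric.isOpen_iff.1 hU p hp
  have hpε : p ∈ ball p ε := mem_ball_self hε
  have hb : TransformsToINB (ball p ε ×ˢ ball p ε) f g :=
    { analytic_f := h.analytic_f.mono fun w hw =>
        ⟨⟨hball hw.1.1, hball hw.1.2⟩, ⟨hball hw.2.1.1, hball hw.2.1.2⟩,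
          ⟨hball hw.2.2.1.1, hball hw.2.2.1.2⟩, ⟨hball hw.2.2.2.1, hball hw.2.2.2.2⟩⟩
      analytic_g := h.analytic_g.mono (Set.prod_mono hball hball)
      deriv_fst_ne := fun x y hw => h.deriv_fst_ne x y ⟨hball hw.1, hball hw.2⟩
      deriv_snd_ne := fun x y hw => h.deriv_snd_ne x y ⟨hball hw.1, hball hw.2⟩
      determining := fun v3 v2 v1 v0 vm1 vm2 h3 h2 h1 h0 hm =>
        h.determining v3 v2 v1 v0 vm1 vm2 ⟨hball h3.1, hball h3.2⟩ ⟨hball h2.1, hball h2.2⟩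
          ⟨hball h1.1, hball h1.2⟩ ⟨hball h0.1, hball h0.2⟩ ⟨hball hm.1, hball hm.2⟩ }
  suffices hs : IsLocallyModification (ball p ε) p f g by
    obtain ⟨V, hVo, hpV, hVb, hV⟩ := hs
    exact ⟨V, hVo, hpV, hVb.trans hball, hV⟩
  obtain ⟨α, β, hα, hβ, hαβ, hQ, hP⟩ := hb.exists_affine isOpen_ball hpε
  -- Since A and B have no zeros, αA = βB carries the vanishing or nonvanishing of α at p to all
  -- values of β, and the vanishing of β back to α.
  by_cases hαp : α p = 0
  · have hβ0 : ∀ z ∈ ball p ε, β z = 0 := fun z hz => by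
      have := hαβ p hpε z hz
      rw [hαp, zero_mul] at this
      exact (mul_eq_zero.1 this.symm).resolve_right (hb.partialSnd_ne hpε hz)
    have hα0 : ∀ y ∈ ball p ε, α y = 0 := fun y hy => by
      have := hαβ y hy p hpε
      rw [hβ0 p hpε, zero_mul] at this
      exact (mul_eq_zero.1 this).resolve_right (hb.partialFst_ne hy hpε)
    obtain ⟨e, l, C, R, n, hC, hR, hRR, hn, hlp, hl, hg, hf⟩ :=
      hb.separable_normal_form hpε
        (fun x hx y hy => sub_eq_zero.1 (by rw [hQ x hx y hy, hα0 y hy, zero_mul]))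
        (fun z hz w hw => sub_eq_zero.1 (by rw [hP z hz w hw, hβ0 z hz, zero_mul]))
    exact isLocallyModification_of_exp isOpen_ball hpε hC hR hRR hn hlp hl hg hf
  · have hβ0 : ∀ z ∈ ball p ε, β z ≠ 0 := fun z hz h0 => by
      have := hαβ p hpε z hz
      rw [h0, zero_mul] at this
      exact mul_ne_zero hαp (hb.partialFst_ne hpε hz) this
    obtain ⟨μ, c, hmap, hf⟩ := hb.coupled_normal_form hpε hα hβ hαβ hQ hP hβ0
    have hβd : DifferentiableOn ℂ (fun x => (β x)⁻¹) (ball p ε) := fun x hx =>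
      ((hβ x hx).fun_inv (hβ0 x hx)).differentiableWithinAt
    obtain ⟨b, hbd⟩ := hβd.isExactOn_ball
    by_cases hμ : μ = 0
    · subst hμ
      exact isLocallyModification_of_difference isOpen_ball (convex_ball p ε).isPreconnected hpε
        hb.analytic_g (fun x hx y hy => hb.partialFst_ne hx hy)
        (fun x hx y hy => hb.partialSnd_ne hx hy) hβ0 hbd (c := c)
        (fun x hx y hy => ⟨by linear_combination (hmap x hx y hy).1,
          by linear_combination (hmap x hx y hy).2⟩)
        (by simpa only [sub_zero] using hf)
    · exact isLocallyModification_of_function_of_difference isOpen_ball hpε hb.analytic_g hβ0 hbd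
        hμ hmap hf (fun x hx y hy => hb.partialSnd_ne hx hy)

end CoupledPointChange

theorem theorem2 :
    (∀ (U : Set ℂ) (f : FivePointRHS) (g : FirstOrderMap), IsOpen U →
      TransformsToINB (U ×ˢ U) f g →
      ∀ p ∈ U, ∃ V : Set ℂ, IsOpen V ∧ p ∈ V ∧ V ⊆ U ∧
        ∃ (θ : ℂ → ℂ) (η : ℂ) (F : FivePointRHS) (G : FirstOrderMap),
          IsPointChange V θ η f F g G ∧ FirstLevelModification ((θ '' V) ×ˢ (θ '' V)) F G) ∧
    (∀ (D : Set (ℂ × ℂ)) (F : FivePointRHS) (G : FirstOrderMap), IsOpen D →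
      FirstLevelModification D F G → TransformsToINB D F G) :=
  ⟨fun _ _ _ hU h _ hp => h.isLocallyModification hU hp,
    fun _ _ _ hD h => h.transformsToINB hD⟩
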